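/- For $m\ge 1$ let $\mathrm{NC}_m$ be the lattice of noncrossing partitions of $\{1,\dots,m\}$, ordered by refinement. Label a covering relation $\sigma\lessdot\tau$ of $\mathrm{NC}_{n+1}$, in which two blocks $B_1,B_2$ of $\sigma$ are joined to one block $B$ of $\tau$ with $\min B\in B_1$, by the largest element of $B_1$ that is less than all elements of $B_2$. Reading the labels of a maximal chain from bottom to top gives a bijection from the maximal chains of $\mathrm{NC}_{n+1}$ to the parking functions of length $n$, i.e. the $n$-tuples of positive integers whose weakly increasing rearrangement has $i$-th entry at most $i$ for every $i$. For $1<k\le n$ let $\mathrm{PF}_{n,k}$ be the set of parking functions of length $n$ in which $k$ does not occur but each of $k+1,\dots,n$ does, and let $\mathrm{Poset}(\mathrm{PF}_{n,k})$ be the poset whose Hasse diagram is the union of the maximal chains of $\mathrm{NC}_{n+1}$ that correspond to the elements of $\mathrm{PF}_{n,k}$ (its order is in general not the one induced from $\mathrm{NC}_{n+1}$). Theorem. Let $1<k\le n$ and let $\sigma\le\tau$ in $\mathrm{Poset}(\mathrm{PF}_{n,k})$. Then the interval $[\sigma,\tau]$ of $\mathrm{Poset}(\mathrm{PF}_{n,k})$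 is isomorphic, as a poset, either to $$\prod_{i=1}^{j}\mathrm{NC}_{m_i}$$ for some $j\ge 0$ and $m_1,\dots,m_j\ge 1$, or to $$\mathrm{Poset}(\mathrm{PF}_{r,r})\times\prod_{i=1}^{j}\mathrm{NC}_{m_i}$$ for some $r\ge 2$, $j\ge 0$ and $m_1,\dots,m_j\ge 1$. In particular (for $k=n$) this holds for every interval of $\mathrm{Poset}(\mathrm{PF}_{n,n})$. -/

import Mathlib

/-- A partition of `{1, …, n}`, given as an equivalence relation on `Fin n` (the index `i`
stands for the number `i + 1`), is noncrossing if there are no `a < b < c < d` such that `a, c`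
lie in one block and `b, d` lie in a different block. -/
def IsNoncrossing {n : ℕ} (s : Setoid (Fin n)) : Prop :=
  ∀ a b c d : Fin n, a < b → b < c → c < d → s a c → s b d → s a b

/-- The noncrossing partition lattice `NC_n`, as a subposet of the lattice of all partitions
ordered by refinement (finer partitions are smaller). -/
abbrev NC (n : ℕ) : Type :=
  {s : Setoid (Fin n) // IsNoncrossing s}

/-- The parking functions of length `n`: tuples of positive integers that can be rearranged
increasingly so that the `i`-th entry is at most `i`. The position `i : Fin n` stands for the
`(i + 1)`-st place. -/
def ParkingFunctions (n : ℕ) : Set (Fin n → ℕ) :=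
  {a | (∀ i, 1 ≤ a i) ∧
    ∃ p : Equiv.Perm (Fin n), Monotone (a ∘ p) ∧ ∀ i : Fin n, a (p i) ≤ (i : ℕ) + 1}

/-- `PF_{n,k}`: the parking functions of length `n` whose largest missing number is `k`. -/
def PF (n k : ℕ) : Set (Fin n → ℕ) :=
  {a | a ∈ ParkingFunctions n ∧ (∀ i, a i ≠ k) ∧ ∀ l : ℕ, k < l → l ≤ n → ∃ i, a i = l}

/-- `l` is the label of the covering relation `σ ⋖ τ`: the partition `τ` arises from `σ` by
joining the blocks `B₁` and `B₂` to one block, where `B₁` contains the minimum of `B₁ ∪ B₂`, and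
`l` is the largest number in `B₁` which is less than all the elements of `B₂`. -/
def IsEdgeLabel {n : ℕ} (σ τ : NC n) (l : ℕ) : Prop :=
  ∃ B₁ ∈ σ.1.classes, ∃ B₂ ∈ σ.1.classes, B₁ ≠ B₂ ∧ B₁ ∪ B₂ ∈ τ.1.classes ∧
    (∃ m ∈ B₁, IsLeast (B₁ ∪ B₂) m) ∧
    ∃ p : Fin n, IsGreatest {x | x ∈ B₁ ∧ ∀ y ∈ B₂, x < y} p ∧ l = (p : ℕ) + 1

/-- `c` is a maximal chain of `NC_{n+1}`, listed from bottom to top: a path from the bottom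
to the top of the Hasse diagram. -/
structure IsMaximalChainNC {n : ℕ} (c : Fin (n + 1) → NC (n + 1)) : Prop where
  bot : IsBot (c 0)
  covBy : ∀ i : Fin n, c i.castSucc ⋖ c i.succ
  top : IsTop (c (Fin.last n))

/-- The maximal chains of `NC_{n+1}` whose sequence of labels, read from bottom to top, is a
parking function in `PF_{n,k}`. -/
def PFChains (n k : ℕ) : Set (Fin (n + 1) → NC (n + 1)) :=
  {c | IsMaximalChainNC c ∧
    ∃ a ∈ PF n k, ∀ i : Fin n, IsEdgeLabel (c i.castSucc) (c i.succ) (a i)}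

/-- The edge relation of the union of the chains in `PFChains n k`. -/
def PFEdge (n k : ℕ) (σ τ : NC (n + 1)) : Prop :=
  ∃ c ∈ PFChains n k, ∃ i : Fin n, c i.castSucc = σ ∧ c i.succ = τ

/-- The underlying set of `Poset(PF_{n,k})`: the noncrossing partitions that lie on a maximal
chain which corresponds to an element of `PF_{n,k}`. -/
def PosetPF (n k : ℕ) : Type :=
  {π : NC (n + 1) // ∃ c ∈ PFChains n k, ∃ i : Fin (n + 1), c i = π}

theorem PFEdge.le_of_reflTransGen {n k : ℕ} {σ τ : NC (n + 1)}
    (h : Relation.ReflTransGen (PFEdge n k) σ τ) : σ ≤ τ := by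
  induction h with
  | refl => exact le_rfl
  | tail _ h ih =>
    obtain ⟨c, hc, i, rfl, rfl⟩ := h
    exact ih.trans (hc.1.covBy i).le

/-- The order of `Poset(PF_{n,k})`, the poset whose Hasse diagram is the union of the chains:
`σ ≤ τ` if there is a path (possibly of length zero) of edges from `σ` up to `τ`. In general
this is not the order induced from `NC_{n+1}`. -/
instance (n k : ℕ) : PartialOrder (PosetPF n k) where
  le σ τ := Relation.ReflTransGen (PFEdge n k) σ.1 τ.1
  le_refl _ := Relation.ReflTransGen.refl
  le_trans _ _ _ h₁ h₂ := Relation.ReflTransGen.trans h₁ h₂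
  le_antisymm _ _ h₁ h₂ := Subtype.ext
    (le_antisymm (PFEdge.le_of_reflTransGen h₁) (PFEdge.le_of_reflTransGen h₂))

/-!
Number the elements of `{1, …, n + 1}` from `0`, so that `p = k - 1` and `q = k` stand for the
numbers `k` and `k + 1`.

The poset `Poset(PF_{n,k})` can be described without chains (`TailLE`, `PosetPF.le_iff_tailLE`,
`PosetPF.nonempty_iso`). That each of the labels `k + 1, …, n` occurs means that every element
above `q` is either the minimum of its block or related to its predecessor (`TailChained`). That
the label `k` does not occur means that `p` and `q` are only joined in such a way that the minimum
of the block of `p` drops (`MinDrops`). The poset consists of the partitions between `⊥` and `⊤` in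
this restricted order. The chains of `PF_{n,k}` obey the two conditions (`PFChains.tailLE`).
Conversely, two partitions related in the restricted order are connected by covering relations
which obey it (`TailLE.exists_isJoin`), and the labels of a maximal chain of such covering
relations form an element of `PF_{n,k}` (`exists_mem_PFChains`).

The intervals of the restricted order are then decomposed. The elements above `q` can be removed one
by one, and each splits off a factor with at most two elements (`tailLE_split_last`). The
remaining order only involves the condition on the two largest elements `p` and `q` (`MarkedLE`).
An interval `[σ, τ]` of a noncrossing partition lattice splits in two ways. If `C` is a block of
`τ`, it is the product of the intervals for `C` and its complement. If `σ` relates `a < b`, it is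
the product of the intervals for `(a, b]` and its complement, because a block that meets both parts
contains `a` and `b`. Both splittings respect the condition on `p` and `q`, which lives in only one
of the factors, or is void. Only the intervals from `⊥` to `⊤` remain. These are noncrossing
partition lattices, or, in the factor with the condition, `Poset(PF_{r,r})`.
-/

/-! ### Intervals of a relation -/

/-- The interval between `a` and `b` with respect to a relation `r`, ordered by `r`. -/
def RelIcc {X : Type*} (r : X → X → Prop) (a b : X) : Type _ :=
  {x : X // r a x ∧ r x b}

instance {X : Type*} (r : X → X → Prop) (a b : X) : LE (RelIcc r a b) :=
  ⟨fun x y => r x.1 y.1⟩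

/-- Two maps `f` and `g` that identify `r`, on a set `W` containing the interval, with a product
relation split the interval, as soon as every pair of elements of the two image intervals has a
common preimage in `W`. -/
theorem RelIcc.prodIso {X Y Z : Type*} {r : X → X → Prop} {rY : Y → Y → Prop}
    {rZ : Z → Z → Prop} (f : X → Y) (g : X → Z) (W : Set X) {a b : X} (ha : a ∈ W) (hb : b ∈ W)
    (hW : ∀ x, r a x → r x b → x ∈ W) (hanti : ∀ x y, r x y → r y x → x = y)
    (hrefl : ∀ x y, r x y → r y y)
    (h : ∀ x ∈ W, ∀ y ∈ W, r x y ↔ rY (f x) (f y) ∧ rZ (g x) (g y))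
    (surj : ∀ y z, rY (f a) y → rY y (f b) → rZ (g a) z → rZ z (g b) →
      ∃ x ∈ W, f x = y ∧ g x = z) :
    Nonempty (RelIcc r a b ≃o RelIcc rY (f a) (f b) × RelIcc rZ (g a) (g b)) := by
  let F : RelIcc r a b → RelIcc rY (f a) (f b) × RelIcc rZ (g a) (g b) := fun x =>
    have hx := hW x.1 x.2.1 x.2.2
    have h1 := (h a ha x.1 hx).1 x.2.1
    have h2 := (h x.1 hx b hb).1 x.2.2
    (⟨f x.1, h1.1, h2.1⟩, ⟨g x.1, h1.2, h2.2⟩)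
  have hF : ∀ x y, F x ≤ F y ↔ x ≤ y := fun x y =>
    (h x.1 (hW x.1 x.2.1 x.2.2) y.1 (hW y.1 y.2.1 y.2.2)).symm
  have hr : ∀ x : RelIcc r a b, x ≤ x := fun x => hrefl _ _ x.2.1
  have hinj : Function.Injective F := by
    intro x y hxy
    refine Subtype.ext (hanti _ _ ((hF x y).1 ?_) ((hF y x).1 ?_))
    · rw [hxy]; exact (hF y y).2 (hr y)
    · rw [hxy]; exact (hF y y).2 (hr y)
  have hsurj : Function.Surjective F := by
    rintro ⟨⟨y, hy1, hy2⟩, ⟨z, hz1, hz2⟩⟩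
    obtain ⟨x, hx, rfl, rfl⟩ := surj y z hy1 hy2 hz1 hz2
    exact ⟨⟨x, (h a ha x hx).2 ⟨hy1, hz1⟩, (h x hx b hb).2 ⟨hy2, hz2⟩⟩, rfl⟩
  exact ⟨{ Equiv.ofBijective F ⟨hinj, hsurj⟩ with map_rel_iff' := fun {x y} => hF x y }⟩

/-- Relations that agree on a set containing both intervals have isomorphic intervals. -/
theorem RelIcc.congrIso {X : Type*} {r r' : X → X → Prop} {a b : X} (W : Set X)
    (haW : a ∈ W) (hbW : b ∈ W) (hW : ∀ x, r a x → r x b → x ∈ W)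
    (hW' : ∀ x, r' a x → r' x b → x ∈ W)
    (h : ∀ x ∈ W, ∀ y ∈ W, r x y ↔ r' x y) :
    Nonempty (RelIcc r a b ≃o RelIcc r' a b) :=
  ⟨{ toFun := fun x =>
      have hx := hW x.1 x.2.1 x.2.2
      ⟨x.1, (h _ haW _ hx).1 x.2.1, (h _ hx _ hbW).1 x.2.2⟩
     invFun := fun x =>
      have hx := hW' x.1 x.2.1 x.2.2
      ⟨x.1, (h _ haW _ hx).2 x.2.1, (h _ hx _ hbW).2 x.2.2⟩
     left_inv := fun _ => rfl
     right_inv := fun _ => rfl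
     map_rel_iff' := fun {x y} =>
      (h x.1 (hW x.1 x.2.1 x.2.2) y.1 (hW y.1 y.2.1 y.2.2)).symm }⟩

/-! ### Products of noncrossing partition lattices -/

/-- `α` is isomorphic to a finite product of noncrossing partition lattices. -/
def IsProdNC (α : Type*) [LE α] : Prop :=
  ∃ (j : ℕ) (m : Fin j → ℕ), (∀ i, 1 ≤ m i) ∧ Nonempty (α ≃o ((i : Fin j) → NC (m i)))

/-- `α` is isomorphic to a finite product of noncrossing partition lattices, possibly with one
additional factor `Poset(PF_{r,r})`. -/
def IsProdPF (α : Type*) [LE α] : Prop :=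
  IsProdNC α ∨ ∃ r : ℕ, 1 < r ∧ ∃ (j : ℕ) (m : Fin j → ℕ), (∀ i, 1 ≤ m i) ∧
      Nonempty (α ≃o PosetPF r r × ((i : Fin j) → NC (m i)))

theorem IsProdNC.congr {α β : Type*} [LE α] [LE β] (h : IsProdNC β) (e : α ≃o β) :
    IsProdNC α := by
  obtain ⟨j, m, hm, ⟨f⟩⟩ := h
  exact ⟨j, m, hm, ⟨e.trans f⟩⟩

theorem IsProdPF.congr {α β : Type*} [LE α] [LE β] (h : IsProdPF β) (e : α ≃o β) :
    IsProdPF α := by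
  obtain h | ⟨r, hr, j, m, hm, ⟨f⟩⟩ := h
  · exact .inl (h.congr e)
  · exact .inr ⟨r, hr, j, m, hm, ⟨e.trans f⟩⟩

theorem exists_pi_append {j₁ j₂ : ℕ} (m₁ : Fin j₁ → ℕ) (m₂ : Fin j₂ → ℕ) (h₁ : ∀ i, 1 ≤ m₁ i)
    (h₂ : ∀ i, 1 ≤ m₂ i) : ∃ (j : ℕ) (m : Fin j → ℕ), (∀ i, 1 ≤ m i) ∧
      Nonempty (((i : Fin j₁) → NC (m₁ i)) × ((i : Fin j₂) → NC (m₂ i)) ≃o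
        ((i : Fin j) → NC (m i))) := by
  let m' : Fin j₁ ⊕ Fin j₂ → ℕ := Sum.elim m₁ m₂
  let e := finSumFinEquiv (m := j₁) (n := j₂)
  let e₁ : ((i : Fin j₁ ⊕ Fin j₂) → NC (m' i)) ≃o
      ((i : Fin j₁) → NC (m₁ i)) × ((i : Fin j₂) → NC (m₂ i)) :=
    { Equiv.sumPiEquivProdPi (fun i => NC (m' i)) with
      map_rel_iff' := by
        intro x y
        exact ⟨fun h i => Sum.rec (fun i => h.1 i) (fun i => h.2 i) i,
          fun h => ⟨fun i => h _, fun i => h _⟩⟩ }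
  let e₂ : ((i : Fin j₁ ⊕ Fin j₂) → NC (m' i)) ≃o ((i : Fin (j₁ + j₂)) → NC (m' (e.symm i))) :=
    { Equiv.piCongrLeft' (fun i => NC (m' i)) e with
      map_rel_iff' := by
        intro x y
        refine ⟨fun h i => ?_, fun h i => h _⟩
        obtain ⟨i, rfl⟩ := e.symm.surjective i
        exact h i }
  have hm' : ∀ i, 1 ≤ m' i := fun i => Sum.rec h₁ h₂ i
  exact ⟨j₁ + j₂, fun i => m' (e.symm i), fun i => hm' _, ⟨e₁.symm.trans e₂⟩⟩

/-- The product of two order isomorphisms. -/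
def prodOrderIso {α β γ δ : Type*} [LE α] [LE β] [LE γ] [LE δ] (e : α ≃o β) (f : γ ≃o δ) :
    α × γ ≃o β × δ :=
  { Equiv.prodCongr e.toEquiv f.toEquiv with
    map_rel_iff' := fun {_ _} => and_congr e.map_rel_iff f.map_rel_iff }

theorem IsProdNC.prod {α β : Type*} [LE α] [LE β] (hα : IsProdNC α) (hβ : IsProdNC β) :
    IsProdNC (α × β) := by
  obtain ⟨j₁, m₁, h₁, ⟨e₁⟩⟩ := hα
  obtain ⟨j₂, m₂, h₂, ⟨e₂⟩⟩ := hβ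
  obtain ⟨j, m, hm, ⟨e⟩⟩ := exists_pi_append m₁ m₂ h₁ h₂
  exact ⟨j, m, hm, ⟨(prodOrderIso e₁ e₂).trans e⟩⟩

theorem IsProdPF.prod {α β : Type*} [LE α] [LE β] (hα : IsProdPF α) (hβ : IsProdNC β) :
    IsProdPF (α × β) := by
  obtain hα | ⟨r, hr, j₁, m₁, h₁, ⟨e₁⟩⟩ := hα
  · exact .inl (hα.prod hβ)
  · obtain ⟨j₂, m₂, h₂, ⟨e₂⟩⟩ := hβ
    obtain ⟨j, m, hm, ⟨e⟩⟩ := exists_pi_append m₁ m₂ h₁ h₂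
    exact .inr ⟨r, hr, j, m, hm, ⟨(prodOrderIso e₁ e₂).trans <|
      (OrderIso.prodAssoc _ _ _).trans (prodOrderIso (OrderIso.refl _) e)⟩⟩

theorem isProdNC_of_subsingleton {α : Type*} [LE α] [Nonempty α] [Subsingleton α]
    (h : ∀ x : α, x ≤ x) : IsProdNC α :=
  ⟨0, fun i => i.elim0, fun i => i.elim0,
    ⟨{ toFun := fun _ i => i.elim0
       invFun := fun _ => Classical.arbitrary α
       left_inv := fun _ => Subsingleton.elim _ _
       right_inv := fun _ => funext fun i => i.elim0
       map_rel_iff' := fun {x y} =>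
        ⟨fun _ => by rw [Subsingleton.elim x y]; exact h y, fun _ i => i.elim0⟩ }⟩⟩

theorem isProdNC_of_iso {α : Type*} [LE α] {n : ℕ} (hn : 1 ≤ n) (e : α ≃o NC n) : IsProdNC α :=
  ⟨1, fun _ => n, fun _ => hn,
    ⟨e.trans
      { Equiv.funUnique (Fin 1) (NC n) |>.symm with
        map_rel_iff' := fun {_ _} => ⟨fun h => h 0, fun h _ => h⟩ }⟩⟩

theorem isProdPF_of_iso {α : Type*} [LE α] {r : ℕ} (hr : 1 < r) (e : α ≃o PosetPF r r) :
    IsProdPF α :=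
  .inr ⟨r, hr, 0, fun i => i.elim0, fun i => i.elim0,
    ⟨e.trans <| OrderIso.symm
      { Equiv.prodUnique (PosetPF r r) ((i : Fin 0) → NC i.elim0) with
        map_rel_iff' := fun {_ _} => ⟨fun h => ⟨h, fun i => i.elim0⟩, fun h => h.1⟩ }⟩⟩

/-! ### The marked order -/

/-- Noncrossing equivalence relations on an arbitrary linear order. -/
def Noncrossing {α : Type*} [LinearOrder α] (s : Setoid α) : Prop :=
  ∀ a b c d : α, a < b → b < c → c < d → s a c → s b d → s a b

/-- The order of the noncrossing partition lattice, as a relation on all equivalence relations that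
holds only between noncrossing ones. -/
def NCLe {α : Type*} [LinearOrder α] (s t : Setoid α) : Prop :=
  Noncrossing s ∧ Noncrossing t ∧ s ≤ t

/-- If the blocks of `p` and `q` are joined between `s` and `t`, then the block of `p` in `t` has a
smaller minimum than the block of `p` in `s`. -/
def MinDrops {α : Type*} [LinearOrder α] (p q : α) (s t : Setoid α) : Prop :=
  t p q → ¬ s p q → ∃ x, t x p ∧ ∀ y, s y p → x < y

/-- The refinement order of noncrossing partitions, restricted by the condition that `p` and `q`
may only be joined while the minimum of the block of `p` drops. -/
def MarkedLE {α : Type*} [LinearOrder α] (p q : α) (s t : Setoid α) : Prop :=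
  NCLe s t ∧ MinDrops p q s t

section
variable {α : Type*} [LinearOrder α]

theorem NCLe.antisymm {s t : Setoid α} (h : NCLe s t) (h' : NCLe t s) : s = t :=
  le_antisymm h.2.2 h'.2.2

theorem NCLe.refl_right {s t : Setoid α} (h : NCLe s t) : NCLe t t := ⟨h.2.1, h.2.1, le_rfl⟩

theorem NCLe.refl_left {s t : Setoid α} (h : NCLe s t) : NCLe s s := ⟨h.1, h.1, le_rfl⟩

theorem NCLe.trans {s t u : Setoid α} (h : NCLe s t) (h' : NCLe t u) : NCLe s u :=
  ⟨h.1, h'.2.1, h.2.2.trans h'.2.2⟩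

theorem MinDrops.refl (p q : α) (s : Setoid α) : MinDrops p q s s := fun h h' => absurd h h'

theorem MarkedLE.trans {p q : α} {s t u : Setoid α} (h : MarkedLE p q s t)
    (h' : MarkedLE p q t u) : MarkedLE p q s u := by
  refine ⟨h.1.trans h'.1, fun hu hs => ?_⟩
  by_cases ht : t p q
  · obtain ⟨x, hx, hx'⟩ := h.2 ht hs
    exact ⟨x, h'.1.2.2 hx, hx'⟩
  · obtain ⟨x, hx, hx'⟩ := h'.2 hu ht
    exact ⟨x, hx, fun y hy => hx' y (h.1.2.2 hy)⟩

theorem MarkedLE.refl_right {p q : α} {s t : Setoid α} (h : MarkedLE p q s t) :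
    MarkedLE p q t t := ⟨h.1.refl_right, .refl _ _ _⟩

theorem MarkedLE.refl_left {p q : α} {s t : Setoid α} (h : MarkedLE p q s t) :
    MarkedLE p q s s := ⟨h.1.refl_left, .refl _ _ _⟩

end

/-- If the block of `q` reaches to the left of `p`, then the block of `p` is nested between two
elements of it, so joining the two lowers the minimum. -/
theorem minDrops_of_rel_of_lt {α : Type*} [LinearOrder α] {s t : Setoid α} {a p q : α}
    (hs : Noncrossing s) (hst : s ≤ t) (hap : a < p) (hpq : p < q) (haq : s a q) :
    MinDrops p q s t := by
  refine fun htpq hspq => ⟨a, t.trans' (hst haq) (t.symm' htpq), fun y hy => ?_⟩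
  by_contra hya
  rcases (not_lt.1 hya).eq_or_lt with rfl | hya
  · exact hspq (s.trans' (s.symm' hy) haq)
  · exact hspq (s.trans' (s.symm' hy) (s.trans' (hs y a p q hya hap hpq hy haq) haq))

theorem noncrossing_bot {α : Type*} [LinearOrder α] : Noncrossing (⊥ : Setoid α) :=
  fun _ _ _ _ hab hbc _ hac _ => absurd hac (hab.trans hbc).ne

theorem noncrossing_top {α : Type*} [LinearOrder α] : Noncrossing (⊤ : Setoid α) :=
  fun _ _ _ _ _ _ _ _ _ => trivial

/-! ### Gluing and joining equivalence relations -/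

/-- The restriction of an equivalence relation to a subset. -/
def Setoid.restrict {α : Type*} (C : Set α) (s : Setoid α) : Setoid C :=
  s.comap Subtype.val

theorem Setoid.restrict_rel {α : Type*} {C : Set α} {s : Setoid α} {x y : C} :
    s.restrict C x y ↔ s x.1 y.1 := Iff.rfl

theorem Noncrossing.restrict {α : Type*} [LinearOrder α] {s : Setoid α} (hs : Noncrossing s)
    (C : Set α) : Noncrossing (s.restrict C) :=
  fun a b c d hab hbc hcd hac hbd => hs a.1 b.1 c.1 d.1 hab hbc hcd hac hbd

/-- The union of an equivalence relation on `C` and one on the complement of `C`. -/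
def Setoid.glue {α : Type*} {C : Set α} (s : Setoid C) (t : Setoid ↑Cᶜ) : Setoid α where
  r x y := (∃ (hx : x ∈ C) (hy : y ∈ C), s ⟨x, hx⟩ ⟨y, hy⟩) ∨
    ∃ (hx : x ∉ C) (hy : y ∉ C), t ⟨x, hx⟩ ⟨y, hy⟩
  iseqv :=
    { refl := fun x => by
        by_cases hx : x ∈ C
        · exact .inl ⟨hx, hx, s.refl' _⟩
        · exact .inr ⟨hx, hx, t.refl' _⟩
      symm := by
        rintro x y (⟨hx, hy, h⟩ | ⟨hx, hy, h⟩)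
        · exact .inl ⟨hy, hx, s.symm' h⟩
        · exact .inr ⟨hy, hx, t.symm' h⟩
      trans := by
        rintro x y z (⟨hx, hy, h⟩ | ⟨hx, hy, h⟩) (⟨hy', hz, h'⟩ | ⟨hy', hz, h'⟩)
        · exact .inl ⟨hx, hz, s.trans' h h'⟩
        · exact absurd hy hy'
        · exact absurd hy' hy
        · exact .inr ⟨hx, hz, t.trans' h h'⟩ }

/-- The equivalence relation that arises from `s` by joining the blocks of `x` and `y`. -/
def Setoid.join {α : Type*} (s : Setoid α) (x y : α) : Setoid α where
  r u v := s u v ∨ (s u x ∧ s v y) ∨ (s u y ∧ s v x)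
  iseqv :=
    { refl := fun u => .inl (s.refl' u)
      symm := by
        rintro u v (h | ⟨h, h'⟩ | ⟨h, h'⟩)
        · exact .inl (s.symm' h)
        · exact .inr (.inr ⟨h', h⟩)
        · exact .inr (.inl ⟨h', h⟩)
      trans := by
        have symm := fun {a b} => s.symm' (x := a) (y := b)
        have trans := fun {a b c} => s.trans' (x := a) (y := b) (z := c)
        rintro u v w (h | ⟨h, h'⟩ | ⟨h, h'⟩) (k | ⟨k, k'⟩ | ⟨k, k'⟩)
        · exact .inl (trans h k)
        · exact .inr (.inl ⟨trans h k, k'⟩)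
        · exact .inr (.inr ⟨trans h k, k'⟩)
        · exact .inr (.inl ⟨h, trans (symm k) h'⟩)
        · exact .inl (trans (trans h (trans (symm k) h')) (symm k'))
        · exact .inl (trans h (symm k'))
        · exact .inr (.inr ⟨h, trans (symm k) h'⟩)
        · exact .inl (trans h (symm k'))
        · exact .inl (trans (trans h (trans (symm k) h')) (symm k')) }

theorem Setoid.join_rel {α : Type*} {s : Setoid α} {x y u v : α} :
    s.join x y u v ↔ s u v ∨ (s u x ∧ s v y) ∨ (s u y ∧ s v x) := Iff.rfl

theorem Setoid.glue_rel {α : Type*} {C : Set α} {s : Setoid C} {t : Setoid ↑Cᶜ} {x y : α} :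
    s.glue t x y ↔ (∃ (hx : x ∈ C) (hy : y ∈ C), s ⟨x, hx⟩ ⟨y, hy⟩) ∨
    ∃ (hx : x ∉ C) (hy : y ∉ C), t ⟨x, hx⟩ ⟨y, hy⟩ := Iff.rfl

theorem Setoid.restrict_glue {α : Type*} {C : Set α} (s : Setoid C) (t : Setoid ↑Cᶜ) :
    (s.glue t).restrict C = s := by
  ext ⟨x, hx⟩ ⟨y, hy⟩
  simp [restrict_rel, glue_rel, hx, hy]

theorem Setoid.restrict_compl_glue {α : Type*} {C : Set α} (s : Setoid C) (t : Setoid ↑Cᶜ) :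
    (s.glue t).restrict Cᶜ = t := by
  ext ⟨x, hx⟩ ⟨y, hy⟩
  have hx' : x ∉ C := hx
  have hy' : y ∉ C := hy
  simp [restrict_rel, glue_rel, hx', hy']

/-! ### Splitting intervals -/

section
variable {α : Type*} [LinearOrder α]

/-- A gluing that refines a noncrossing `τ` is noncrossing if `C` is a union of blocks of `τ`: a
crossing of the two parts would be one in `τ`. -/
theorem Noncrossing.glue_of_saturated {τ : Setoid α} (hτ : Noncrossing τ) {C : Set α}
    (hC : ∀ x y, τ x y → x ∈ C → y ∈ C) {s : Setoid C} {t : Setoid ↑Cᶜ}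
    (hs : Noncrossing s) (ht : Noncrossing t) (hle : s.glue t ≤ τ) : Noncrossing (s.glue t) := by
  intro a b c d hab hbc hcd hac hbd
  have hτab : τ a b := hτ a b c d hab hbc hcd (hle hac) (hle hbd)
  obtain ⟨ha, hc, h⟩ | ⟨ha, hc, h⟩ := hac <;> obtain ⟨hb, hd, h'⟩ | ⟨hb, hd, h'⟩ := hbd
  · exact .inl ⟨ha, hb, hs _ _ _ _ hab hbc hcd h h'⟩
  · exact absurd (hC _ _ hτab ha) hb
  · exact absurd (hC _ _ (τ.symm' hτab) hb) ha
  · exact .inr ⟨ha, hb, ht _ _ _ _ hab hbc hcd h h'⟩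

theorem nCLe_iff_of_saturated {τ : Setoid α} {C : Set α}
    (hC : ∀ x y, τ x y → x ∈ C → y ∈ C) {s t : Setoid α} (hs : Noncrossing s)
    (ht : Noncrossing t) (hsτ : s ≤ τ) :
    NCLe s t ↔ NCLe (s.restrict C) (t.restrict C) ∧ NCLe (s.restrict Cᶜ) (t.restrict Cᶜ) := by
  constructor
  · exact fun h => ⟨⟨hs.restrict _, ht.restrict _, fun x y hxy => h.2.2 hxy⟩,
      ⟨hs.restrict _, ht.restrict _, fun x y hxy => h.2.2 hxy⟩⟩
  · refine fun h => ⟨hs, ht, fun x y hxy => ?_⟩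
    by_cases hx : x ∈ C
    · exact h.1.2.2 (x := ⟨x, hx⟩) (y := ⟨y, hC _ _ (hsτ hxy) hx⟩) hxy
    · exact h.2.2.2 (x := ⟨x, hx⟩)
        (y := ⟨y, fun hy => hx (hC _ _ (τ.symm' (hsτ hxy)) hy)⟩) hxy

theorem exists_glue_of_saturated {τ : Setoid α} (hτ : Noncrossing τ) {C : Set α}
    (hC : ∀ x y, τ x y → x ∈ C → y ∈ C) {s : Setoid C} {t : Setoid ↑Cᶜ}
    (hs : NCLe s (τ.restrict C)) (ht : NCLe t (τ.restrict Cᶜ)) :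
    ∃ x ∈ {u | Noncrossing u ∧ u ≤ τ}, x.restrict C = s ∧ x.restrict Cᶜ = t := by
  have hle : s.glue t ≤ τ := by
    rintro x y (⟨hx, hy, h⟩ | ⟨hx, hy, h⟩)
    · exact hs.2.2 h
    · exact ht.2.2 h
  exact ⟨s.glue t, ⟨hτ.glue_of_saturated hC hs.1 ht.1 hle, hle⟩, s.restrict_glue t,
    s.restrict_compl_glue t⟩

/-- Below a partition `τ` with a block, or union of blocks, `C`, the lattice is a product. -/
theorem nCLe_split_of_saturated {σ τ : Setoid α} (h : NCLe σ τ) {C : Set α}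
    (hC : ∀ x y, τ x y → x ∈ C → y ∈ C) :
    Nonempty (RelIcc NCLe σ τ ≃o RelIcc NCLe (σ.restrict C) (τ.restrict C) ×
      RelIcc NCLe (σ.restrict Cᶜ) (τ.restrict Cᶜ)) :=
  RelIcc.prodIso _ _ {u | Noncrossing u ∧ u ≤ τ} ⟨h.1, h.2.2⟩ ⟨h.2.1, le_rfl⟩
    (fun _ _ hx => ⟨hx.1, hx.2.2⟩) (fun _ _ => NCLe.antisymm) (fun _ _ => NCLe.refl_right)
    (fun _ hx _ hy => nCLe_iff_of_saturated hC hx.1 hy.1 hx.2)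
    (fun _ _ _ hy _ hz => exists_glue_of_saturated h.2.1 hC hy hz)

theorem markedLE_iff_of_saturated {τ : Setoid α} {C : Set α}
    (hC : ∀ x y, τ x y → x ∈ C → y ∈ C) {p q : α} (hp : p ∈ C) (hq : q ∈ C) {s t : Setoid α}
    (hs : Noncrossing s) (ht : Noncrossing t) (hsτ : s ≤ τ) (htτ : t ≤ τ) :
    MarkedLE p q s t ↔ MarkedLE ⟨p, hp⟩ ⟨q, hq⟩ (s.restrict C) (t.restrict C) ∧
      NCLe (s.restrict Cᶜ) (t.restrict Cᶜ) := by
  have key : MinDrops p q s t ↔ MinDrops ⟨p, hp⟩ ⟨q, hq⟩ (s.restrict C) (t.restrict C) := by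
    refine forall₂_congr fun htpq hspq => ⟨?_, ?_⟩
    · rintro ⟨x, hx, hx'⟩
      exact ⟨⟨x, hC _ _ (τ.symm' (htτ hx)) hp⟩, hx, fun y hy => hx' _ hy⟩
    · rintro ⟨x, hx, hx'⟩
      exact ⟨x.1, hx, fun y hy => hx' ⟨y, hC _ _ (τ.symm' (hsτ hy)) hp⟩ hy⟩
  unfold MarkedLE
  rw [nCLe_iff_of_saturated hC hs ht hsτ, key]
  tauto

theorem markedLE_split_of_saturated {σ τ : Setoid α} {p q : α} (h : MarkedLE p q σ τ) {C : Set α}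
    (hC : ∀ x y, τ x y → x ∈ C → y ∈ C) (hp : p ∈ C) (hq : q ∈ C) :
    Nonempty (RelIcc (MarkedLE p q) σ τ ≃o
      RelIcc (MarkedLE ⟨p, hp⟩ ⟨q, hq⟩) (σ.restrict C) (τ.restrict C) ×
      RelIcc NCLe (σ.restrict Cᶜ) (τ.restrict Cᶜ)) :=
  RelIcc.prodIso _ _ {u | Noncrossing u ∧ u ≤ τ} ⟨h.1.1, h.1.2.2⟩ ⟨h.1.2.1, le_rfl⟩
    (fun _ _ hx => ⟨hx.1.1, hx.1.2.2⟩) (fun _ _ hx hy => hx.1.antisymm hy.1)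
    (fun _ _ => MarkedLE.refl_right)
    (fun _ hs _ ht => markedLE_iff_of_saturated hC hp hq hs.1 ht.1 hs.2 ht.2)
    (fun _ _ _ hy _ hz => exists_glue_of_saturated h.1.2.1 hC hy.1 hz)

/-- If `a` and `b` are in one block, then a block that meets both `Ioc a b` and its complement is
the block of `a` and `b`: otherwise the two would cross. -/
theorem Noncrossing.rel_of_mem_Ioc {s : Setoid α} (hs : Noncrossing s) {a b u v : α}
    (hab : s a b) (hu : u ∈ Set.Ioc a b) (hv : v ∉ Set.Ioc a b) (h : s u v) : s u b := by
  have symm := fun {a b} => s.symm' (x := a) (y := b)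
  have trans := fun {a b c} => s.trans' (x := a) (y := b) (z := c)
  rcases hu.2.eq_or_lt with rfl | hub
  · exact s.refl' _
  rcases lt_trichotomy v a with hva | rfl | hav
  · exact trans h (trans (hs v a u b hva hu.1 hub (symm h) hab) hab)
  · exact trans h hab
  · have : b < v := by
      by_contra hvb
      exact hv ⟨hav, not_lt.1 hvb⟩
    exact trans (symm (hs a u b v hu.1 hub this hab h)) hab

theorem nCLe_iff_of_rel {a b : α} {s t : Setoid α} (hs : Noncrossing s)
    (ht : Noncrossing t) (hsab : s a b) (htab : t a b) :
    NCLe s t ↔ NCLe (s.restrict (Set.Ioc a b)ᶜ) (t.restrict (Set.Ioc a b)ᶜ) ∧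
      NCLe (s.restrict (Set.Ioc a b)) (t.restrict (Set.Ioc a b)) := by
  have symm := fun {s : Setoid α} {a b} => s.symm' (x := a) (y := b)
  have trans := fun {s : Setoid α} {a b c} => s.trans' (x := a) (y := b) (z := c)
  constructor
  · exact fun h => ⟨⟨hs.restrict _, ht.restrict _, fun x y hxy => h.2.2 hxy⟩,
      ⟨hs.restrict _, ht.restrict _, fun x y hxy => h.2.2 hxy⟩⟩
  · intro h
    -- a block that meets both parts contains `a` and `b`
    have key : ∀ {u v}, u ∈ Set.Ioc a b → v ∉ Set.Ioc a b → s u v → t u v := by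
      intro u v hu hv huv
      have hsub := hs.rel_of_mem_Ioc hsab hu hv huv
      have h1 : t u b := h.2.2.2 (x := ⟨u, hu⟩) (y := ⟨b, hu.1.trans_le hu.2, le_rfl⟩) hsub
      have h2 : t v a := h.1.2.2 (x := ⟨v, hv⟩) (y := ⟨a, by simp⟩)
        (trans (symm huv) (trans hsub (symm hsab)))
      exact trans h1 (trans (symm htab) (symm h2))
    refine ⟨hs, ht, fun x y hxy => ?_⟩
    by_cases hx : x ∈ Set.Ioc a b <;> by_cases hy : y ∈ Set.Ioc a b
    · exact h.2.2.2 (x := ⟨x, hx⟩) (y := ⟨y, hy⟩) hxy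
    · exact key hx hy hxy
    · exact symm (key hy hx (symm hxy))
    · exact h.1.2.2 (x := ⟨x, hx⟩) (y := ⟨y, hy⟩) hxy

/-- Partitions of `Ioc a b` and of its complement can be combined by joining the blocks of `a` and
`b`. So the noncrossing partitions in which `a` and `b` are related form a product. -/
theorem noncrossing_join_glue {a b : α} {s : Setoid (Set.Ioc a b)}
    {t : Setoid ↑(Set.Ioc a b)ᶜ} (hs : Noncrossing s) (ht : Noncrossing t) (hab : a < b) :
    Noncrossing ((s.glue t).join a b) := by
  have hbC : b ∈ Set.Ioc a b := ⟨hab, le_rfl⟩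
  have haC : a ∉ Set.Ioc a b := by simp
  set G := s.glue t with hG
  have hin : ∀ {u v}, G u v → (u ∈ Set.Ioc a b ↔ v ∈ Set.Ioc a b) := by
    rintro u v (⟨hu, hv, -⟩ | ⟨hu, hv, -⟩) <;> simp only [hu, hv]
  have hGnc : ∀ {a' b' c' d'}, a' < b' → b' < c' → c' < d' → G a' c' → G b' d' →
      (a' ∈ Set.Ioc a b ↔ b' ∈ Set.Ioc a b) → G a' b' := by
    rintro a' b' c' d' h1 h2 h3 (⟨ha, hc, h⟩ | ⟨ha, hc, h⟩) (⟨hb, hd, h'⟩ | ⟨hb, hd, h'⟩) hh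
    · exact .inl ⟨ha, hb, hs _ _ _ _ h1 h2 h3 h h'⟩
    · exact absurd (hh.1 ha) hb
    · exact absurd (hh.2 hb) ha
    · exact .inr ⟨ha, hb, ht _ _ _ _ h1 h2 h3 h h'⟩
  have symm := fun {a b} => G.symm' (x := a) (y := b)
  have trans := fun {a b c} => G.trans' (x := a) (y := b) (z := c)
  have refl := fun {a} => G.refl' a
  intro a' b' c' d' h1 h2 h3 hac hbd
  rw [Setoid.join_rel] at hac hbd ⊢
  simp only [Set.mem_Ioc] at *
  -- each pair is related by `G` or by the new link between `a` and `b`; in the mixed cases `a` or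
  -- `b` takes the place of one of the four elements in `hGnc`
  obtain hac | ⟨ha, hc⟩ | ⟨ha, hc⟩ := hac <;> obtain hbd | ⟨hb, hd⟩ | ⟨hb, hd⟩ := hbd
  · have e1 := hin hac
    have e2 := hin hbd
    exact .inl (hGnc h1 h2 h3 hac hbd (by grind))
  · have e1 := hin hac
    have e2 := hin hb
    have e3 := hin hd
    have := @hGnc a' b' c' a h1 h2
    clear hGnc hin hs ht
    grind
  · have e1 := hin hac
    have e2 := hin hb
    have e3 := hin hd
    have := @hGnc a' b' c' b h1 h2
    have := @hGnc a' a c' d'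
    clear hGnc hin hs ht
    grind
  · have e1 := hin hbd
    have e2 := hin ha
    have e3 := hin hc
    have := @hGnc a' b' a d' h1
    have := @hGnc b' c' d' b h2 h3
    clear hGnc hin hs ht
    grind
  · exact .inl (trans ha (symm hb))
  · exact .inr (.inl ⟨ha, hb⟩)
  · have e1 := hin hbd
    have e2 := hin ha
    have e3 := hin hc
    have := @hGnc a b' c' d'
    clear hGnc hin hs ht
    grind
  · exact .inr (.inr ⟨ha, hb⟩)
  · exact .inl (trans ha (symm hb))

end

theorem Setoid.restrict_join_glue {α : Type*} {C : Set α} (s : Setoid C) (t : Setoid ↑Cᶜ)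
    {a b : α} (ha : a ∉ C) : ((s.glue t).join a b).restrict C = s := by
  ext ⟨x, hx⟩ ⟨y, hy⟩
  simp [restrict_rel, join_rel, glue_rel, hx, hy, ha]

theorem Setoid.restrict_compl_join_glue {α : Type*} {C : Set α} (s : Setoid C)
    (t : Setoid ↑Cᶜ) {a b : α} (hb : b ∈ C) :
    ((s.glue t).join a b).restrict Cᶜ = t := by
  ext ⟨x, hx⟩ ⟨y, hy⟩
  have hx' : x ∉ C := hx
  have hy' : y ∉ C := hy
  simp [restrict_rel, join_rel, glue_rel, hx', hy', hb]

theorem exists_glue_of_lt {α : Type*} [LinearOrder α] {a b : α} (hab : a < b)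
    {s : Setoid (Set.Ioc a b)} {t : Setoid ↑(Set.Ioc a b)ᶜ} (hs : Noncrossing s)
    (ht : Noncrossing t) :
    ∃ x ∈ {u : Setoid α | Noncrossing u ∧ u a b},
      x.restrict (Set.Ioc a b)ᶜ = t ∧ x.restrict (Set.Ioc a b) = s := by
  have ha : a ∉ Set.Ioc a b := by simp
  have hb : b ∈ Set.Ioc a b := ⟨hab, le_rfl⟩
  refine ⟨(s.glue t).join a b, ⟨noncrossing_join_glue hs ht hab, ?_⟩,
    Setoid.restrict_compl_join_glue s t hb, Setoid.restrict_join_glue s t ha⟩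
  exact .inr (.inl ⟨Setoid.refl' _ _, Setoid.refl' _ _⟩)

theorem nCLe_split_of_rel {α : Type*} [LinearOrder α] {σ τ : Setoid α} (h : NCLe σ τ) {a b : α}
    (hab : a < b) (hσ : σ a b) :
    Nonempty (RelIcc NCLe σ τ ≃o
      RelIcc NCLe (σ.restrict (Set.Ioc a b)ᶜ) (τ.restrict (Set.Ioc a b)ᶜ) ×
      RelIcc NCLe (σ.restrict (Set.Ioc a b)) (τ.restrict (Set.Ioc a b))) :=
  RelIcc.prodIso _ _ {u | Noncrossing u ∧ u a b} ⟨h.1, hσ⟩ ⟨h.2.1, h.2.2 hσ⟩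
    (fun _ hx _ => ⟨hx.2.1, hx.2.2 hσ⟩) (fun _ _ => NCLe.antisymm)
    (fun _ _ => NCLe.refl_right)
    (fun _ hx _ hy => nCLe_iff_of_rel hx.1 hy.1 hx.2 hy.2)
    (fun _ _ hy _ hz _ => exists_glue_of_lt hab hz.2.1 hy.2.1)

/-- The mark may move from `p` to another element of its block. -/
theorem minDrops_congr_left {α : Type*} [LinearOrder α] {a p q : α} {s t : Setoid α}
    (hs : s a p) (ht : t a p) : MinDrops p q s t ↔ MinDrops a q s t := by
  have hs' : ∀ u, s u p ↔ s u a := fun u =>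
    ⟨fun h => s.trans' h (s.symm' hs), fun h => s.trans' h hs⟩
  have ht' : ∀ u, t u p ↔ t u a := fun u =>
    ⟨fun h => t.trans' h (t.symm' ht), fun h => t.trans' h ht⟩
  unfold MinDrops
  simp only [hs', ht']
  rw [s.comm' (x := p), hs', t.comm' (x := p), ht', s.comm' (x := a), t.comm' (x := a)]

theorem minDrops_restrict_iff {α : Type*} [LinearOrder α] {a b p q : α} {s t : Setoid α}
    (hs : Noncrossing s) (ht : Noncrossing t) (hsab : s a b) (htab : t a b)
    (hp : p ∈ (Set.Ioc a b)ᶜ) (hq : q ∈ (Set.Ioc a b)ᶜ) :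
    MinDrops p q s t ↔ MinDrops ⟨p, hp⟩ ⟨q, hq⟩ (s.restrict (Set.Ioc a b)ᶜ)
      (t.restrict (Set.Ioc a b)ᶜ) := by
  refine forall₂_congr fun htpq hspq => ⟨?_, ?_⟩
  · rintro ⟨x, hx, hx'⟩
    by_cases hxC : x ∈ Set.Ioc a b
    · -- an element of `Ioc a b` that is related to `p` can be replaced by `a`
      have hxa : t a p := t.trans' htab
        (t.trans' (t.symm' (ht.rel_of_mem_Ioc htab hxC hp hx)) hx)
      exact ⟨⟨a, by simp⟩, hxa, fun y hy => hxC.1.trans (hx' _ hy)⟩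
    · exact ⟨⟨x, hxC⟩, hx, fun y hy => hx' _ hy⟩
  · rintro ⟨x, hx, hx'⟩
    refine ⟨x.1, hx, fun y hy => ?_⟩
    by_cases hyC : y ∈ Set.Ioc a b
    · have hya : s a p := s.trans' hsab
        (s.trans' (s.symm' (hs.rel_of_mem_Ioc hsab hyC hp hy)) hy)
      have hxa : x.1 < a := hx' ⟨a, by simp⟩ hya
      exact hxa.trans hyC.1
    · exact hx' ⟨y, hyC⟩ hy

/-- Here `p` is replaced by `a` if it is the element `b` of `Ioc a b`. -/
theorem markedLE_iff_of_rel {α : Type*} [LinearOrder α] {p p' q a b : α}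
    (hp : p' ∈ (Set.Ioc a b)ᶜ) (hq : q ∈ (Set.Ioc a b)ᶜ) (hpp' : p' = p ∨ p' = a ∧ p = b)
    {s t : Setoid α} (hs : Noncrossing s) (ht : Noncrossing t) (hsab : s a b) (htab : t a b) :
    MarkedLE p q s t ↔ MarkedLE ⟨p', hp⟩ ⟨q, hq⟩ (s.restrict (Set.Ioc a b)ᶜ)
        (t.restrict (Set.Ioc a b)ᶜ) ∧
      NCLe (s.restrict (Set.Ioc a b)) (t.restrict (Set.Ioc a b)) := by
  have key : MinDrops p q s t ↔ MinDrops p' q s t := by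
    obtain rfl | ⟨rfl, rfl⟩ := hpp'
    · rfl
    · exact minDrops_congr_left hsab htab
  unfold MarkedLE
  rw [nCLe_iff_of_rel hs ht hsab htab, key, minDrops_restrict_iff hs ht hsab htab hp hq]
  tauto

theorem markedLE_split_of_rel {α : Type*} [LinearOrder α] {σ τ : Setoid α} {p p' q : α}
    (h : MarkedLE p q σ τ) {a b : α}
    (hab : a < b) (hσ : σ a b) (hp : p' ∈ (Set.Ioc a b)ᶜ) (hq : q ∈ (Set.Ioc a b)ᶜ)
    (hpp' : p' = p ∨ p' = a ∧ p = b) :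
    Nonempty (RelIcc (MarkedLE p q) σ τ ≃o
      RelIcc (MarkedLE ⟨p', hp⟩ ⟨q, hq⟩) (σ.restrict (Set.Ioc a b)ᶜ)
        (τ.restrict (Set.Ioc a b)ᶜ) ×
      RelIcc NCLe (σ.restrict (Set.Ioc a b)) (τ.restrict (Set.Ioc a b))) :=
  RelIcc.prodIso _ _ {u | Noncrossing u ∧ u a b} ⟨h.1.1, hσ⟩ ⟨h.1.2.1, h.1.2.2 hσ⟩
    (fun _ hx _ => ⟨hx.1.2.1, hx.1.2.2 hσ⟩) (fun _ _ hx hy => hx.1.antisymm hy.1)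
    (fun _ _ => MarkedLE.refl_right)
    (fun _ hs _ ht => markedLE_iff_of_rel hp hq hpp' hs.1 ht.1 hs.2 ht.2)
    (fun _ _ hy _ hz _ => exists_glue_of_lt hab hz.2.1 hy.1.2.1)

theorem noncrossing_comap_iff {α β : Type*} [LinearOrder α] [LinearOrder β] (e : α ≃o β)
    (s : Setoid β) : Noncrossing (s.comap e) ↔ Noncrossing s := by
  unfold Noncrossing
  simp only [e.surjective.forall, Setoid.comap_rel, e.lt_iff_lt]

theorem nCLe_comap_iff {α β : Type*} [LinearOrder α] [LinearOrder β] (e : α ≃o β)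
    (s t : Setoid β) : NCLe (s.comap e) (t.comap e) ↔ NCLe s t := by
  unfold NCLe
  simp only [noncrossing_comap_iff, Setoid.le_def, e.surjective.forall, Setoid.comap_rel]

theorem minDrops_comap_iff {α β : Type*} [LinearOrder α] [LinearOrder β] (e : α ≃o β)
    (p q : α) (s t : Setoid β) :
    MinDrops p q (s.comap e) (t.comap e) ↔ MinDrops (e p) (e q) s t := by
  unfold MinDrops
  simp only [e.surjective.forall, e.surjective.exists, Setoid.comap_rel, e.lt_iff_lt]

theorem Setoid.comap_bot_of_injective {α β : Type*} {f : α → β} (hf : Function.Injective f) :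
    (⊥ : Setoid β).comap f = ⊥ := by
  ext x y
  exact hf.eq_iff

theorem Setoid.comap_top {α β : Type*} (f : α → β) : (⊤ : Setoid β).comap f = ⊤ := rfl

/-- A relation `r` and its preimage under an order isomorphism of the ground sets have isomorphic
intervals between the finest and the coarsest partition. -/
theorem relIcc_bot_top_iso {α β : Type*} [LinearOrder α] [LinearOrder β] (e : α ≃o β)
    {r : Setoid α → Setoid α → Prop} {r' : Setoid β → Setoid β → Prop}
    (h : ∀ s t, r (s.comap e) (t.comap e) ↔ r' s t) :
    Nonempty (RelIcc r ⊥ ⊤ ≃o RelIcc r' ⊥ ⊤) := by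
  have hinv : ∀ s : Setoid α, (s.comap e.symm).comap e = s := fun s => by
    ext x y
    simp [Setoid.comap_rel]
  have hinv' : ∀ s : Setoid β, (s.comap e).comap e.symm = s := fun s => by
    ext x y
    simp [Setoid.comap_rel]
  have hbot := Setoid.comap_bot_of_injective e.injective
  have htop := Setoid.comap_top (α := α) (β := β) e
  refine ⟨OrderIso.symm
    { toFun := fun s => ⟨s.1.comap e, ?_, ?_⟩
      invFun := fun s => ⟨s.1.comap e.symm, ?_, ?_⟩
      left_inv := fun s => Subtype.ext (hinv' s.1)
      right_inv := fun s => Subtype.ext (hinv s.1)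
      map_rel_iff' := fun {s t} => h s.1 t.1 }⟩
  · rw [← hbot, h]
    exact s.2.1
  · rw [← htop, h]
    exact s.2.2
  · rw [← h, hinv, hbot]
    exact s.2.1
  · rw [← h, hinv, htop]
    exact s.2.2

theorem relIcc_nCLe_bot_top_iso (n : ℕ) :
    Nonempty (RelIcc NCLe (⊥ : Setoid (Fin n)) ⊤ ≃o NC n) :=
  ⟨{ toFun := fun s => ⟨s.1, s.2.1.2.1⟩
     invFun := fun s => ⟨s.1, ⟨noncrossing_bot, s.2, bot_le⟩, ⟨s.2, noncrossing_top, le_top⟩⟩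
     left_inv := fun _ => rfl
     right_inv := fun _ => rfl
     map_rel_iff' := fun {s t} => ⟨fun h => ⟨s.2.1.2.1, t.2.1.2.1, h⟩, fun h => h.2.2⟩ }⟩

theorem Setoid.eq_bot_of_forall_lt {α : Type*} [LinearOrder α] {s : Setoid α}
    (h : ∀ a b, a < b → ¬ s a b) : s = ⊥ := by
  refine le_antisymm (fun a b hab => ?_) bot_le
  by_contra hne
  rcases lt_or_gt_of_ne (show a ≠ b from hne) with hlt | hlt
  · exact h _ _ hlt hab
  · exact h _ _ hlt (s.symm' hab)

theorem Setoid.eq_top_of_forall {α : Type*} {s : Setoid α} (h : ∀ a b, s a b) : s = ⊤ :=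
  le_antisymm le_top fun _ _ _ => h _ _

/-- Every interval of a noncrossing partition lattice is a product of such lattices. -/
theorem isProdNC_relIcc_nCLe {α : Type} [LinearOrder α] [Finite α] {σ τ : Setoid α}
    (h : NCLe σ τ) : IsProdNC (RelIcc NCLe σ τ) := by
  induction hN : Nat.card α using Nat.strong_induction_on generalizing α with
  | _ N ih =>
  subst hN
  by_cases hτ : ∀ x y, τ x y
  · obtain rfl := Setoid.eq_top_of_forall hτ
    by_cases hσ : ∃ a b, a < b ∧ σ a b
    · obtain ⟨a, b, hab, hσ⟩ := hσ
      obtain ⟨e⟩ := nCLe_split_of_rel h hab hσ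
      have hb : b ∈ Set.Ioc a b := ⟨hab, le_rfl⟩
      have h' := (nCLe_iff_of_rel h.1 h.2.1 hσ trivial).1 h
      refine IsProdNC.congr (.prod (ih _ ?_ h'.1 rfl) (ih _ ?_ h'.2 rfl)) e
      · exact Finite.card_subtype_lt (x := b) (fun hb' => hb' hb)
      · exact Finite.card_subtype_lt (x := a) (by simp)
    · push Not at hσ
      obtain rfl := Setoid.eq_bot_of_forall_lt hσ
      cases nonempty_fintype α
      obtain ⟨e⟩ := relIcc_bot_top_iso (Fintype.orderIsoFinOfCardEq α rfl).symm
        (nCLe_comap_iff _)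
      obtain ⟨e'⟩ := relIcc_nCLe_bot_top_iso (Fintype.card α)
      rcases Nat.eq_zero_or_pos (Fintype.card α) with h0 | h0
      · have := Fintype.card_eq_zero_iff.1 h0
        have : Subsingleton (RelIcc NCLe (⊥ : Setoid α) ⊤) :=
          ⟨fun x y => Subtype.ext (Setoid.ext fun a => this.elim a)⟩
        have : Nonempty (RelIcc NCLe (⊥ : Setoid α) ⊤) := ⟨⟨⊥, h.refl_left, h⟩⟩
        exact isProdNC_of_subsingleton fun x => x.2.1.refl_right
      · exact isProdNC_of_iso h0 (e.trans e')
  · push Not at hτ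
    obtain ⟨x, y, hxy⟩ := hτ
    have hC : ∀ u v, τ u v → u ∈ {z | τ z x} → v ∈ {z | τ z x} :=
      fun u v huv hu => τ.trans' (τ.symm' huv) hu
    obtain ⟨e⟩ := nCLe_split_of_saturated h hC
    have h' := (nCLe_iff_of_saturated hC h.1 h.2.1 h.2.2).1 h
    refine IsProdNC.congr (.prod (ih _ ?_ h'.1 rfl) (ih _ ?_ h'.2 rfl)) e
    · exact Finite.card_subtype_lt (x := y) (fun hy => hxy (τ.symm' hy))
    · exact Finite.card_subtype_lt (x := x) (fun hx => hx (τ.refl' x))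

/-- If no step of an interval violates the condition on `p` and `q`, then the marked order is the
refinement order there. -/
theorem markedLE_iso_of_minDrops {α : Type*} [LinearOrder α] {p q : α} {σ τ : Setoid α}
    (h : NCLe σ τ)
    (h' : ∀ s t, NCLe σ s → NCLe s t → NCLe t τ → MinDrops p q s t) :
    Nonempty (RelIcc (MarkedLE p q) σ τ ≃o RelIcc NCLe σ τ) := by
  refine RelIcc.congrIso {s | NCLe σ s ∧ NCLe s τ} ⟨h.refl_left, h⟩ ⟨h, h.refl_right⟩
    (fun x hx hx' => ⟨hx.1, hx'.1⟩) (fun x hx hx' => ⟨hx, hx'⟩)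
    fun x hx y hy => ⟨fun h => h.1, fun h => ⟨h, h' _ _ hx.1 h hy.2⟩⟩

/-! ### Partitions with a chained tail -/

/-- Every `y > q` that is not the minimum of its block is related to its predecessor. So the part of
the partition above `q` is given by the set of those `y > q` that are joined to their
predecessor. -/
def TailChained {N : ℕ} (q : Fin N) (s : Setoid (Fin N)) : Prop :=
  ∀ x y l : Fin N, q < y → x < y → s x y → (l : ℕ) + 1 = y → s l y

/-- The marked order on the partitions that satisfy `TailChained q`. For `p + 1 = q` this is the
order of `Poset(PF_{n,q})`, see `PosetPF.nonempty_iso`. -/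
def TailLE {N : ℕ} (p q : Fin N) (s t : Setoid (Fin N)) : Prop :=
  MarkedLE p q s t ∧ TailChained q s ∧ TailChained q t

theorem TailLE.trans {N : ℕ} {p q : Fin N} {s t u : Setoid (Fin N)} (h : TailLE p q s t)
    (h' : TailLE p q t u) : TailLE p q s u := ⟨h.1.trans h'.1, h.2.1, h'.2.2⟩

theorem TailLE.refl_right {N : ℕ} {p q : Fin N} {s t : Setoid (Fin N)} (h : TailLE p q s t) :
    TailLE p q t t := ⟨h.1.refl_right, h.2.2, h.2.2⟩

theorem TailLE.refl_left {N : ℕ} {p q : Fin N} {s t : Setoid (Fin N)} (h : TailLE p q s t) :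
    TailLE p q s s := ⟨h.1.refl_left, h.2.1, h.2.1⟩

theorem TailLE.antisymm {N : ℕ} {p q : Fin N} {s t : Setoid (Fin N)} (h : TailLE p q s t)
    (h' : TailLE p q t s) : s = t := h.1.1.antisymm h'.1.1

/-- The partition of `Fin (n + 2)` that extends `s`; the last element is added to the block of
its predecessor if `b` holds, and is a singleton otherwise. -/
noncomputable def extendLast {n : ℕ} (s : Setoid (Fin (n + 1))) (b : Prop) :
    Setoid (Fin (n + 2)) :=
  open Classical in
  Setoid.ker (Fin.lastCases (motive := fun _ => Option (Quotient s))
    (if b then some (Quotient.mk s (Fin.last n)) else none) fun i => some (Quotient.mk s i))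

theorem extendLast_castSucc {n : ℕ} {s : Setoid (Fin (n + 1))} {b : Prop} {i j : Fin (n + 1)} :
    extendLast s b i.castSucc j.castSucc ↔ s i j := by
  unfold extendLast
  rw [Setoid.ker_def]
  simp [Quotient.eq]

theorem extendLast_last {n : ℕ} {s : Setoid (Fin (n + 1))} {b : Prop} {i : Fin (n + 1)} :
    extendLast s b i.castSucc (Fin.last (n + 1)) ↔ b ∧ s i (Fin.last n) := by
  unfold extendLast
  rw [Setoid.ker_def]
  by_cases hb : b <;> simp [Quotient.eq, hb]

theorem comap_castSucc_extendLast {n : ℕ} (s : Setoid (Fin (n + 1))) (b : Prop) :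
    (extendLast s b).comap Fin.castSucc = s := by
  ext i j
  exact extendLast_castSucc

theorem noncrossing_extendLast {n : ℕ} {s : Setoid (Fin (n + 1))} (hs : Noncrossing s)
    (b : Prop) : Noncrossing (extendLast s b) := by
  intro w x y z hwx hxy hyz hwy hxz
  obtain ⟨y, rfl⟩ := Fin.exists_castSucc_eq.2 (Fin.ne_last_of_lt hyz)
  obtain ⟨x, rfl⟩ := Fin.exists_castSucc_eq.2 (Fin.ne_last_of_lt hxy)
  obtain ⟨w, rfl⟩ := Fin.exists_castSucc_eq.2 (Fin.ne_last_of_lt hwx)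
  simp only [Fin.castSucc_lt_castSucc_iff, extendLast_castSucc] at *
  induction z using Fin.lastCases with
  | last =>
    have hx := (extendLast_last.1 hxz).2
    rcases (Fin.le_last y).eq_or_lt with rfl | hy
    · exact s.trans' hwy (s.symm' hx)
    · exact hs w x y _ hwx hxy hy hwy hx
  | cast z =>
    simp only [Fin.castSucc_lt_castSucc_iff, extendLast_castSucc] at *
    exact hs w x y z hwx hxy hyz hwy hxz

theorem TailChained.comap_castSucc {n : ℕ} {q : Fin (n + 1)} {s : Setoid (Fin (n + 2))}
    (hs : TailChained q.castSucc s) : TailChained q (s.comap Fin.castSucc) :=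
  fun x y l hqy hxy h hl => hs x.castSucc y.castSucc l.castSucc hqy hxy h hl

theorem Noncrossing.comap_castSucc {n : ℕ} {s : Setoid (Fin (n + 2))}
    (hs : Noncrossing s) : Noncrossing (s.comap Fin.castSucc) :=
  fun a b c d hab hbc hcd => hs a.castSucc b.castSucc c.castSucc d.castSucc hab hbc hcd

theorem tailChained_extendLast {n : ℕ} {q : Fin (n + 1)} {s : Setoid (Fin (n + 1))}
    (hs : TailChained q s) (b : Prop) : TailChained q.castSucc (extendLast s b) := by
  intro x y l hqy hxy h hl
  obtain ⟨x, rfl⟩ := Fin.exists_castSucc_eq.2 (Fin.ne_last_of_lt hxy)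
  obtain ⟨l, rfl⟩ := Fin.exists_castSucc_eq.2
    (Fin.ne_last_of_lt (show l < y from Fin.lt_def.2 (by omega)))
  induction y using Fin.lastCases with
  | last =>
    obtain rfl : l = Fin.last n := Fin.ext (by simpa using hl)
    exact extendLast_last.2 ⟨(extendLast_last.1 h).1, s.refl' _⟩
  | cast y =>
    exact extendLast_castSucc.2 (hs x y l hqy hxy (extendLast_castSucc.1 h) (by simpa using hl))

theorem TailChained.rel_last {n : ℕ} {q i : Fin (n + 1)} {s : Setoid (Fin (n + 2))}
    (hs : TailChained q.castSucc s) (h : s i.castSucc (Fin.last (n + 1))) :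
    s (Fin.last n).castSucc (Fin.last (n + 1)) :=
  hs i.castSucc _ _ (Fin.castSucc_lt_last q) (Fin.castSucc_lt_last i) h (by simp)

theorem tailLE_iff_comap_castSucc {n : ℕ} {p q : Fin (n + 1)} {s t : Setoid (Fin (n + 2))}
    (hs : Noncrossing s) (ht : Noncrossing t) (hs' : TailChained q.castSucc s)
    (ht' : TailChained q.castSucc t) :
    TailLE p.castSucc q.castSucc s t ↔
      TailLE p q (s.comap Fin.castSucc) (t.comap Fin.castSucc) ∧
      (s (Fin.last n).castSucc (Fin.last (n + 1)) →
        t (Fin.last n).castSucc (Fin.last (n + 1))) := by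
  have hle : s ≤ t ↔ s.comap Fin.castSucc ≤ t.comap Fin.castSucc ∧
      (s (Fin.last n).castSucc (Fin.last (n + 1)) →
        t (Fin.last n).castSucc (Fin.last (n + 1))) := by
    refine ⟨fun h => ⟨fun i j hij => h hij, fun h' => h h'⟩, fun ⟨h, h'⟩ x y hxy => ?_⟩
    have key : ∀ i : Fin (n + 1), s i.castSucc (Fin.last (n + 1)) →
        t i.castSucc (Fin.last (n + 1)) := fun i hi =>
      have hl := hs'.rel_last hi
      t.trans' (h (s.trans' hi (s.symm' hl))) (h' hl)
    induction x using Fin.lastCases with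
    | last =>
      induction y using Fin.lastCases with
      | last => exact t.refl' _
      | cast y => exact t.symm' (key y (s.symm' hxy))
    | cast x =>
      induction y using Fin.lastCases with
      | last => exact key x hxy
      | cast y => exact h hxy
  have hdrop : MinDrops p.castSucc q.castSucc s t ↔
      MinDrops p q (s.comap Fin.castSucc) (t.comap Fin.castSucc) := by
    refine forall₂_congr fun htpq hspq => ⟨?_, ?_⟩
    · rintro ⟨x, hx, hx'⟩
      obtain ⟨x, rfl⟩ := Fin.exists_castSucc_eq.2 (Fin.ne_last_of_lt (hx' _ (s.refl' _)))
      exact ⟨x, hx, fun y hy => hx' y.castSucc hy⟩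
    · rintro ⟨x, hx, hx'⟩
      refine ⟨x.castSucc, hx, fun y hy => ?_⟩
      induction y using Fin.lastCases with
      | last => exact Fin.castSucc_lt_last x
      | cast y => exact hx' y hy
  unfold TailLE MarkedLE NCLe
  simp only [hs, ht, hs', ht', hle, hdrop, hs.comap_castSucc, ht.comap_castSucc,
    hs'.comap_castSucc, ht'.comap_castSucc, true_and, and_true]
  tauto

/-- Only the predecessor of the last element decides about the block of the last element, so
removing the last element splits off a factor with at most two elements. -/
theorem tailLE_split_last {n : ℕ} {p q : Fin (n + 1)} {σ τ : Setoid (Fin (n + 2))}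
    (h : TailLE p.castSucc q.castSucc σ τ) :
    Nonempty (RelIcc (TailLE p.castSucc q.castSucc) σ τ ≃o
      RelIcc (TailLE p q) (σ.comap Fin.castSucc) (τ.comap Fin.castSucc) ×
      RelIcc (fun a b : Prop => a → b) (σ (Fin.last n).castSucc (Fin.last (n + 1)))
        (τ (Fin.last n).castSucc (Fin.last (n + 1)))) := by
  refine RelIcc.prodIso (rY := TailLE p q) (rZ := fun a b => a → b) (fun s => s.comap Fin.castSucc)
    (fun s => s (Fin.last n).castSucc (Fin.last (n + 1)))
    {s | Noncrossing s ∧ TailChained q.castSucc s}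
    ⟨h.1.1.1, h.2.1⟩ ⟨h.1.1.2.1, h.2.2⟩
    (fun _ hx _ => ⟨hx.1.1.2.1, hx.2.2⟩) (fun _ _ => TailLE.antisymm)
    (fun _ _ => TailLE.refl_right)
    (fun _ hs _ ht => tailLE_iff_comap_castSucc hs.1 ht.1 hs.2 ht.2)
    (fun s b hs _ _ _ => ⟨extendLast s b, ⟨noncrossing_extendLast hs.1.1.2.1 b,
      tailChained_extendLast hs.2.2 b⟩, comap_castSucc_extendLast s b, ?_⟩)
  exact propext (extendLast_last.trans (and_iff_left (s.refl' _)))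

theorem isProdNC_relIcc_prop {a b : Prop} (hab : a → b) :
    IsProdNC (RelIcc (fun a b : Prop => a → b) a b) := by
  by_cases h : ¬ a ∧ b
  · refine isProdNC_of_iso (n := 2) one_le_two
      { toFun := fun x => ⟨⟨fun i j => i = j ∨ x.1, fun i => .inl rfl, ?_, ?_⟩, ?_⟩
        invFun := fun s => ⟨s.1 0 1, fun ha => absurd ha h.1, fun _ => h.2⟩
        left_inv := fun x => Subtype.ext (propext (or_iff_right Fin.zero_ne_one))
        right_inv := fun s => Subtype.ext ?_
        map_rel_iff' := fun {x y} => ⟨fun h => ?_, fun h i j => Or.imp_right h⟩ }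
    · exact fun h => h.imp_left Eq.symm
    · rintro i j k (rfl | h) (rfl | h')
      exacts [.inl rfl, .inr h', .inr h, .inr h]
    · intro a b c d hab hbc hcd
      omega
    · ext i j
      change (i = j ∨ s.1 0 1) ↔ s.1 i j
      fin_cases i <;> fin_cases j
      · exact ⟨fun _ => s.1.refl' _, fun _ => .inl rfl⟩
      · exact ⟨fun h => h.resolve_left Fin.zero_ne_one, .inr⟩
      · exact ⟨fun h => s.1.symm' (h.resolve_left Fin.zero_ne_one.symm),
          fun h => .inr (s.1.symm' h)⟩
      · exact ⟨fun _ => s.1.refl' _, fun _ => .inl rfl⟩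
    · exact fun hx => (h (x := 0) (y := 1) (.inr hx)).resolve_left Fin.zero_ne_one
  · have : Subsingleton (RelIcc (fun a b : Prop => a → b) a b) :=
      ⟨fun x y => Subtype.ext (propext (by have := x.2; have := y.2; tauto))⟩
    have : Nonempty (RelIcc (fun a b : Prop => a → b) a b) := ⟨⟨a, id, hab⟩⟩
    exact isProdNC_of_subsingleton fun x => id

/-! ### Covering relations -/

/-- `t` arises from `s` by joining the block of `x` with the block of `y`, where `y` is the minimum
of its block and `x` is the largest element of the other block below `y`. This is the covering
relation with label `x` in a normal form. -/
structure IsJoin {α : Type*} [LinearOrder α] (s t : Setoid α) (x y : α) : Prop where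
  lt : x < y
  min : ∀ z, s z y → y ≤ z
  pred : ∀ z, s z x → z < y → z ≤ x
  eq : t = s.join x y

section
variable {α : Type*} [LinearOrder α] {s t : Setoid α} {x y : α}

/-- Joining the blocks of `x < y` keeps a partition noncrossing if the blocks that could be enclosed
between `x` and `y` stay inside. Only blocks in the same block of a coarser noncrossing
partition `t` matter. -/
theorem Noncrossing.join (hs : Noncrossing s) (ht : Noncrossing t) (hst : s ≤ t) (hxy : x < y)
    (htxy : t x y)
    (H : ∀ z, x < z → z < y → t z x → ∀ z', s z' z → x < z' ∧ z' < y) :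
    Noncrossing (s.join x y) := by
  have hle : s.join x y ≤ t := by
    rintro u v (h | ⟨h, h'⟩ | ⟨h, h'⟩)
    · exact hst h
    · exact t.trans' (hst h) (t.trans' htxy (t.symm' (hst h')))
    · exact t.trans' (hst h) (t.trans' (t.symm' htxy) (t.symm' (hst h')))
  intro a b c d hab hbc hcd hac hbd
  have htab := ht a b c d hab hbc hcd (hle hac) (hle hbd)
  have htac := hle hac
  have htbd := hle hbd
  have symm := fun {a b} => s.symm' (x := a) (y := b)
  have trans := fun {a b c} => s.trans' (x := a) (y := b) (z := c)
  have refl := fun {a} => s.refl' a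
  have tsymm := fun {a b} => t.symm' (x := a) (y := b)
  have ttrans := fun {a b c} => t.trans' (x := a) (y := b) (z := c)
  rw [Setoid.join_rel] at hac hbd ⊢
  -- in the mixed cases `x` or `y` takes the place of one of the four elements in `hs`, and `H`
  -- excludes a block that leaves the gap between `x` and `y`
  obtain hac | ⟨ha, hc⟩ | ⟨ha, hc⟩ := hac <;> obtain hbd | ⟨hb, hd⟩ | ⟨hb, hd⟩ := hbd
  · exact .inl (hs _ _ _ _ hab hbc hcd hac hbd)
  · have htcx : t c x := ttrans (tsymm (ttrans (tsymm htab) htac)) (hst hb)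
    have h1 := H c
    have := hs a b c x hab hbc
    have := hs a y c d
    have := hs x a b c
    have := lt_trichotomy c x
    have := lt_trichotomy c y
    have := lt_trichotomy a y
    clear hs ht H hle tsymm ttrans
    grind
  · have htcx : t c x := ttrans (tsymm (ttrans (tsymm htab) htac)) (ttrans htbd (hst hd))
    have htax : t a x := ttrans htac htcx
    have h1 := H c
    have h2 := H a
    have := hs a b c y hab hbc
    have := hs a x c d
    have := hs y a b c
    have := lt_trichotomy c y
    have := lt_trichotomy a y
    have := lt_trichotomy a x
    clear hs ht H hle tsymm ttrans
    grind
  · have htbx : t b x := ttrans (tsymm htab) (hst ha)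
    have h1 := H b
    have := hs a b x d hab
    have := hs b c d y hbc hcd
    have := hs y b c d
    have := lt_trichotomy b x
    have := lt_trichotomy b y
    have := lt_trichotomy d x
    clear hs ht H hle tsymm ttrans
    grind
  · exact .inl (trans ha (symm hb))
  · exact .inr (.inl ⟨ha, hb⟩)
  · have htbx : t b x := ttrans (tsymm htab) (ttrans htac (hst hc))
    have htdx : t d x := ttrans (tsymm htbd) htbx
    have h1 := H d
    have h2 := H b
    have := hs a b y d hab
    have := hs b c d x hbc hcd
    have := hs x b c d
    have := lt_trichotomy b x
    have := lt_trichotomy b y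
    have := lt_trichotomy d x
    have := lt_trichotomy d y
    clear hs ht H hle tsymm ttrans
    grind
  · exact .inr (.inr ⟨ha, hb⟩)
  · exact .inl (trans ha (symm hb))

theorem IsJoin.rel_iff (h : IsJoin s t x y) {u v : α} :
    t u v ↔ s u v ∨ (s u x ∧ s v y) ∨ (s u y ∧ s v x) := by
  rw [h.eq]
  rfl

theorem IsJoin.le (h : IsJoin s t x y) : s ≤ t := fun _ _ huv => h.rel_iff.2 (.inl huv)

theorem IsJoin.rel (h : IsJoin s t x y) : t x y :=
  h.rel_iff.2 (.inr (.inl ⟨s.refl' _, s.refl' _⟩))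

theorem IsJoin.not_rel (h : IsJoin s t x y) : ¬ s x y := fun hxy => (h.min _ hxy).not_gt h.lt

theorem IsJoin.rel_left_iff (h : IsJoin s t x y) {u : α} : t u x ↔ s u x ∨ s u y := by
  rw [h.rel_iff]
  constructor
  · rintro (h' | ⟨h', -⟩ | ⟨h', -⟩)
    exacts [.inl h', .inl h', .inr h']
  · rintro (h' | h')
    exacts [.inl h', .inr (.inr ⟨h', s.refl' _⟩)]

end

theorem Setoid.exists_min_rel {N : ℕ} (s : Setoid (Fin N)) (x : Fin N) :
    ∃ m, s m x ∧ ∀ z, s z x → m ≤ z := by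
  obtain ⟨m, hm, hm'⟩ := Set.exists_min_image {z | s z x} id (Set.toFinite _) ⟨x, s.refl' x⟩
  exact ⟨m, hm, hm'⟩

theorem Setoid.exists_pred_rel {N : ℕ} (s : Setoid (Fin N)) {x y : Fin N} (hxy : s x y)
    (hlt : x < y) : ∃ m, s m y ∧ m < y ∧ ∀ z, s z y → z < y → z ≤ m := by
  obtain ⟨m, hm, hm'⟩ := Set.exists_max_image {z | s z y ∧ z < y} id (Set.toFinite _)
    ⟨x, hxy, hlt⟩
  exact ⟨m, hm.1, hm.2, fun z hz hz' => hm' z ⟨hz, hz'⟩⟩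

theorem IsJoin.covBy {N : ℕ} {σ τ : NC N} {x y : Fin N} (h : IsJoin σ.1 τ.1 x y) : σ ⋖ τ := by
  refine ⟨lt_of_le_not_ge h.le fun hle => h.not_rel (hle h.rel), fun c hσc hcτ => ?_⟩
  obtain ⟨u, v, hc, hσ⟩ : ∃ u v, c.1 u v ∧ ¬ σ.1 u v := by
    by_contra! hall
    exact hσc.not_ge fun u v => hall u v
  have symm := fun {a b} => c.1.symm' (x := a) (y := b)
  have trans := fun {a b d} => c.1.trans' (x := a) (y := b) (z := d)
  have hle : ∀ {u v}, σ.1 u v → c.1 u v := fun huv => hσc.le huv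
  have hxy : c.1 x y := by
    rcases h.rel_iff.1 (hcτ.le hc) with h' | ⟨h1, h2⟩ | ⟨h1, h2⟩
    · exact absurd h' hσ
    · exact trans (symm (hle h1)) (trans hc (hle h2))
    · exact trans (symm (hle h2)) (trans (symm hc) (hle h1))
  refine hcτ.not_ge fun u v huv => ?_
  rcases h.rel_iff.1 huv with h' | ⟨h1, h2⟩ | ⟨h1, h2⟩
  · exact hle h'
  · exact trans (hle h1) (trans hxy (symm (hle h2)))
  · exact trans (hle h1) (trans (symm hxy) (symm (hle h2)))

theorem IsJoin.isEdgeLabel {N : ℕ} {σ τ : NC N} {x y : Fin N} (h : IsJoin σ.1 τ.1 x y) :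
    IsEdgeLabel σ τ (x + 1) := by
  obtain ⟨m, hm, hm'⟩ := σ.1.exists_min_rel x
  refine ⟨{z | σ.1 z x}, ⟨x, rfl⟩, {z | σ.1 z y}, ⟨y, rfl⟩, fun heq => h.not_rel ?_, ⟨x, ?_⟩,
    ⟨m, hm, .inl hm, ?_⟩, x, ⟨⟨σ.1.refl' x, fun z hz => h.lt.trans_le (h.min z hz)⟩, ?_⟩, rfl⟩
  · have : x ∈ {z | σ.1 z x} := σ.1.refl' x
    rwa [heq] at this
  · ext z
    exact h.rel_left_iff.symm
  · rintro z (hz | hz)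
    · exact hm' z hz
    · exact (hm' x (σ.1.refl' x)).trans (h.lt.le.trans (h.min z hz))
  · exact fun z hz => h.pred z hz.1 (hz.2 y (σ.1.refl' y))

theorem IsEdgeLabel.exists_isJoin {N : ℕ} {σ τ : NC N} {l : ℕ} (h : IsEdgeLabel σ τ l)
    (hcov : σ ⋖ τ) : ∃ x y, IsJoin σ.1 τ.1 x y ∧ l = x + 1 := by
  obtain ⟨_, ⟨x₀, rfl⟩, _, ⟨y₀, rfl⟩, hne, ⟨w, hw⟩, ⟨m, hm, -, hm'⟩, x, ⟨⟨hx, hxlt⟩, hxmax⟩, rfl⟩ :=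
    h
  obtain ⟨y, hy, hymin⟩ := σ.1.exists_min_rel y₀
  have hle : ∀ {u v}, σ.1 u v → τ.1 u v := fun huv => hcov.le huv
  have symm := fun {a b} => σ.1.symm' (x := a) (y := b)
  have trans := fun {a b d} => σ.1.trans' (x := a) (y := b) (z := d)
  have hxy : x < y := hxlt y hy
  have hmin : ∀ z, σ.1 z y → y ≤ z := fun z hz => hymin z (trans hz hy)
  have hpred : ∀ z, σ.1 z x → z < y → z ≤ x := fun z hz hzy =>
    hxmax ⟨trans hz hx, fun v hv => hzy.trans_le (hymin v hv)⟩
  have hτ : ∀ z, τ.1 z w ↔ σ.1 z x ∨ σ.1 z y := by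
    intro z
    have : z ∈ {z | σ.1 z x₀} ∪ {z | σ.1 z y₀} ↔ τ.1 z w := by rw [hw]; rfl
    rw [← this]
    exact or_congr ⟨fun h => trans h (symm hx), fun h => trans h hx⟩
      ⟨fun h => trans h (symm hy), fun h => trans h hy⟩
  have hτxy : τ.1 x y := τ.1.trans' ((hτ x).2 (.inl (σ.1.refl' x)))
    (τ.1.symm' ((hτ y).2 (.inr (σ.1.refl' y))))
  have hnc : Noncrossing (σ.1.join x y) := by
    refine Noncrossing.join σ.2 τ.2 hcov.le hxy hτxy fun z hxz hzy hz => ?_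
    rcases (hτ z).1 (τ.1.trans' hz ((hτ x).2 (.inl (σ.1.refl' x)))) with h | h
    · exact absurd hxz (hpred z h hzy).not_gt
    · exact absurd hzy (hmin z h).not_gt
  refine ⟨x, y, ⟨hxy, hmin, hpred, ?_⟩, rfl⟩
  have h1 : σ < (⟨σ.1.join x y, hnc⟩ : NC N) := by
    refine lt_of_le_not_ge (fun u v huv => .inl huv) fun hge => (hmin x ?_).not_gt hxy
    exact hge (.inr (.inl ⟨σ.1.refl' x, σ.1.refl' y⟩))
  have h2 : (⟨σ.1.join x y, hnc⟩ : NC N) ≤ τ := by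
    rintro u v (h | ⟨h, h'⟩ | ⟨h, h'⟩)
    · exact hle h
    · exact τ.1.trans' (hle h) (τ.1.trans' hτxy (τ.1.symm' (hle h')))
    · exact τ.1.trans' (hle h) (τ.1.trans' (τ.1.symm' hτxy) (τ.1.symm' (hle h')))
  exact congrArg Subtype.val ((h2.eq_or_lt).resolve_right (hcov.2 h1)).symm

/-! ### Saturated chains in the restricted order -/

theorem TailChained.rel_of_lt_of_le {N : ℕ} {q : Fin N} {s : Setoid (Fin N)}
    (hs : TailChained q s) {w z : Fin N} (hwq : w < q) (hqz : q ≤ z) (h : s w z) : s w q := by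
  obtain ⟨d, hd⟩ : ∃ d : ℕ, (z : ℕ) = q + d := ⟨z - q, by have := Fin.le_def.1 hqz; omega⟩
  induction d generalizing z with
  | zero => exact (show z = q from Fin.ext hd) ▸ h
  | succ d ih =>
    have hl : s ⟨q + d, by omega⟩ z := hs w z _ (Fin.lt_def.2 (by omega)) (hwq.trans_le hqz) h
      (by simp only; omega)
    exact ih (Fin.le_def.2 (by simp)) (s.trans' h (s.symm' hl)) rfl

/-- A join that is noncrossing because of the gap between `x` and `y` is a covering relation in
normal form and remains tail-chained. -/
theorem exists_isJoin_of_gap {N : ℕ} {p q : Fin N} {s t : Setoid (Fin N)} (h : TailLE p q s t)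
    {x y : Fin N} (hxy : x < y) (hy : ∀ z, s z y → y ≤ z) (htxy : t x y)
    (H : ∀ z, x < z → z < y → t z x → ∀ z', s z' z → x < z' ∧ z' < y)
    (hpred : q < y → ∀ z, t z y → z < y → z ≤ x) :
    IsJoin s (s.join x y) x y ∧ Noncrossing (s.join x y) ∧ s.join x y ≤ t ∧
      TailChained q (s.join x y) := by
  have hst : s ≤ t := h.1.1.2.2
  refine ⟨⟨hxy, hy, fun z hzx hzy => ?_, rfl⟩, h.1.1.1.join h.1.1.2.1 hst hxy htxy H, ?_, ?_⟩
  · exact not_lt.1 fun hxz => lt_irrefl _ (H z hxz hzy (hst hzx) x (s.symm' hzx)).1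
  · rintro u v (h | ⟨h, h'⟩ | ⟨h, h'⟩)
    · exact hst h
    · exact t.trans' (hst h) (t.trans' htxy (t.symm' (hst h')))
    · exact t.trans' (hst h) (t.trans' (t.symm' htxy) (t.symm' (hst h')))
  · intro x' y' l hqy' hxy' hu hl
    have hly : l < y' := Fin.lt_def.2 (by omega)
    by_cases hmin : ∃ w < y', s w y'
    · obtain ⟨w, hw, hw'⟩ := hmin
      exact .inl (h.2.1 w y' l hqy' hw hw' hl)
    push Not at hmin
    rcases hu with hu | ⟨h1, h2⟩ | ⟨h1, h2⟩
    · exact absurd hu (hmin _ hxy')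
    · obtain rfl : y' = y :=
        le_antisymm (not_lt.1 fun hlt => hmin _ hlt (s.symm' h2)) (hy _ h2)
      have htl : t l y' := h.2.2 x y' l hqy' hxy htxy hl
      obtain rfl : l = x := le_antisymm (hpred hqy' l htl hly) (by
        rw [Fin.le_def]; have := Fin.lt_def.1 hxy; omega)
      exact .inr (.inl ⟨s.refl' _, s.refl' _⟩)
    · exact absurd (hxy.trans_le (hy _ h1)) (not_lt.2 <| hxy'.le.trans <|
        not_lt.1 fun hlt => hmin _ hlt (s.symm' h2))

/-- Between two partitions related by `TailLE` there is a first covering relation. -/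
theorem TailLE.exists_isJoin {N : ℕ} {p q : Fin N} (hpq : (p : ℕ) + 1 = q)
    {s t : Setoid (Fin N)} (h : TailLE p q s t) (hne : s ≠ t) :
    ∃ u x y, IsJoin s u x y ∧ TailLE p q s u ∧ TailLE p q u t := by
  have hst : s ≤ t := h.1.1.2.2
  have hplt : p < q := Fin.lt_def.2 (by omega)
  by_cases hq : t p q ∧ ¬ s p q ∧ ∀ z, s z q → q ≤ z
  · obtain ⟨htpq, hspq, hqmin⟩ := hq
    -- joining `q` directly to `p`, or lowering the minimum of the block of `p` too early, is
    -- forbidden: `q` is joined to the block of the last element before the block of `p`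
    obtain ⟨y₀, hy₀, hy₀min⟩ := s.exists_min_rel p
    obtain ⟨x₀, hx₀, hx₀lt⟩ := h.1.2 htpq hspq
    obtain ⟨x, hx, hxy₀, hxmax⟩ := t.exists_pred_rel (t.trans' hx₀ (t.symm' (hst hy₀)))
      (hx₀lt _ hy₀)
    have hy₀p : y₀ ≤ p := hy₀min p (s.refl' p)
    have hxp : t x p := t.trans' hx (hst hy₀)
    have hxq : x < q := hxy₀.trans_le (hy₀p.trans hplt.le)
    have hsxp : ¬ s x p := fun h' => (hy₀min x h').not_gt hxy₀
    obtain ⟨hj, hnc, hle, htail⟩ := exists_isJoin_of_gap h hxq hqmin (t.trans' hxp htpq)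
      (fun z hxz hzq hz z' hz' => by
        have hz₀ : y₀ ≤ z := not_lt.1 fun hlt => (hxmax z (t.trans' hz hx) hlt).not_gt hxz
        have hzp : z ≤ p := by rw [Fin.le_def]; have := Fin.lt_def.1 hzq; omega
        refine ⟨?_, not_le.1 fun hqz' => ?_⟩
        · by_cases hsz : s z p
          · exact hxy₀.trans_le (hy₀min _ (s.trans' hz' hsz))
          · by_contra hz'x
            have hlt : z' < y₀ := (not_lt.1 hz'x).trans_lt hxy₀
            have h1 : y₀ < z := lt_of_le_of_ne hz₀ fun heq => hsz (heq ▸ hy₀)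
            have h2 : z < p := lt_of_le_of_ne hzp fun heq => hsz (heq ▸ s.refl' _)
            exact hsz (s.trans' (s.symm' hz')
              (s.trans' (h.1.1.1 z' y₀ z p hlt h1 h2 hz' hy₀) hy₀))
        · exact (hqmin z (h.2.1.rel_of_lt_of_le hzq hqz' (s.symm' hz'))).not_gt hzq)
      (fun hlt => absurd hlt (lt_irrefl _))
    refine ⟨_, x, q, hj, ⟨⟨⟨h.1.1.1, hnc, hj.le⟩, fun hu hs => ?_⟩, h.2.1, htail⟩,
      ⟨⟨⟨hnc, h.1.1.2.1, hle⟩, fun _ _ => ⟨x, hxp, fun z hz => ?_⟩⟩, htail, h.2.2⟩⟩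
    · rcases hu with h' | ⟨h', -⟩ | ⟨h', -⟩
      · exact absurd h' hs
      · exact absurd (s.symm' h') hsxp
      · exact absurd h' hs
    · rcases hz with h' | ⟨-, h'⟩ | ⟨-, h'⟩
      · exact hxy₀.trans_le (hy₀min _ h')
      · exact absurd h' hspq
      · exact absurd (s.symm' h') hsxp
  -- otherwise any `y` that is minimal for `s` but not for `t` can be joined to its `t`-predecessor
  · obtain ⟨y, hymin, w, hwy, htwy⟩ : ∃ y, (∀ z, s z y → y ≤ z) ∧ ∃ w < y, t w y := by
      by_contra! hall
      refine hne (le_antisymm hst fun u v huv => ?_)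
      obtain ⟨u₀, hu₀, humin⟩ := s.exists_min_rel u
      obtain ⟨v₀, hv₀, hvmin⟩ := s.exists_min_rel v
      have huv₀ : t u₀ v₀ := t.trans' (hst hu₀) (t.trans' huv (t.symm' (hst hv₀)))
      have h1 := hall u₀ fun z hz => humin z (s.trans' hz hu₀)
      have h2 := hall v₀ fun z hz => hvmin z (s.trans' hz hv₀)
      obtain rfl : u₀ = v₀ := le_antisymm (not_lt.1 fun hlt => h1 _ hlt (t.symm' huv₀))
        (not_lt.1 fun hlt => h2 _ hlt huv₀)
      exact s.trans' (s.symm' hu₀) hv₀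
    obtain ⟨x, hx, hxy, hxmax⟩ := t.exists_pred_rel htwy hwy
    obtain ⟨hj, hnc, hle, htail⟩ := exists_isJoin_of_gap h hxy hymin hx
      (fun z hxz hzy hz => absurd hxz (hxmax z (t.trans' hz hx) hzy).not_gt)
      (fun _ => hxmax)
    have key : ∀ {s' t' : Setoid (Fin N)}, Noncrossing s' → s ≤ s' → s' ≤ t' → t' ≤ t →
        MinDrops p q s' t' := by
      intro s' t' hs' hss' hst' htt' ht' hs'pq
      have hspq : ¬ s p q := fun h' => hs'pq (hss' h')
      obtain ⟨b, hb, hbq⟩ : ∃ b, s b q ∧ b < q := by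
        by_contra! hall
        exact hq ⟨htt' ht', hspq, hall⟩
      have hbp : b < p := by
        refine lt_of_le_of_ne (by rw [Fin.le_def]; have := Fin.lt_def.1 hbq; omega) ?_
        rintro rfl
        exact hspq hb
      exact minDrops_of_rel_of_lt hs' hst' hbp hplt (hss' hb) ht' hs'pq
    exact ⟨_, x, y, hj, ⟨⟨⟨h.1.1.1, hnc, hj.le⟩, key h.1.1.1 le_rfl hj.le hle⟩, h.2.1, htail⟩,
      ⟨⟨⟨hnc, h.1.1.2.1, hle⟩, key hnc hj.le hle le_rfl⟩, htail, h.2.2⟩⟩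

/-- The set of the elements that are not the minimum of their block. -/
def nonMin {N : ℕ} (s : Setoid (Fin N)) : Set (Fin N) := {y | ∃ x < y, s x y}

theorem IsJoin.nonMin_eq {N : ℕ} {s t : Setoid (Fin N)} {x y : Fin N} (h : IsJoin s t x y) :
    nonMin t = insert y (nonMin s) := by
  ext z
  constructor
  · rintro ⟨w, hwz, hw⟩
    rcases h.rel_iff.1 hw with h' | ⟨-, h'⟩ | ⟨h', h''⟩
    · exact .inr ⟨w, hwz, h'⟩
    · rcases (h.min z h').eq_or_lt with rfl | hlt
      · exact .inl rfl
      · exact .inr ⟨y, hlt, s.symm' h'⟩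
    · exact .inr ⟨x, h.lt.trans_le ((h.min w h').trans hwz.le), s.symm' h''⟩
  · rintro (rfl | ⟨w, hw, hw'⟩)
    · exact ⟨x, h.lt, h.rel⟩
    · exact ⟨w, hw, h.le hw'⟩

/-- The number of elements that are not the minimum of their block, which is the rank in the
noncrossing partition lattice. -/
noncomputable def ncRank {N : ℕ} (s : Setoid (Fin N)) : ℕ := (nonMin s).ncard

theorem IsJoin.ncRank_eq {N : ℕ} {s t : Setoid (Fin N)} {x y : Fin N} (h : IsJoin s t x y) :
    ncRank t = ncRank s + 1 := by
  rw [ncRank, h.nonMin_eq, Set.ncard_insert_of_notMem _ (Set.toFinite _)]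
  · rfl
  · rintro ⟨w, hw, hw'⟩
    exact (h.min w hw').not_gt hw

theorem ncRank_bot {N : ℕ} : ncRank (⊥ : Setoid (Fin N)) = 0 := by
  rw [ncRank, Set.ncard_eq_zero]
  ext y
  exact ⟨fun ⟨x, hx, hxy⟩ => hx.ne hxy, fun h => h.elim⟩

theorem ncRank_top {n : ℕ} : ncRank (⊤ : Setoid (Fin (n + 1))) = n := by
  have : nonMin (⊤ : Setoid (Fin (n + 1))) = {0}ᶜ := by
    ext y
    exact ⟨fun ⟨x, hx, _⟩ => Fin.ne_zero_of_lt hx, fun h => ⟨0, Fin.pos_of_ne_zero h, trivial⟩⟩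
  rw [ncRank, this, Set.ncard_compl]
  simp

theorem ncRank_le {N : ℕ} (s : Setoid (Fin N)) : ncRank s ≤ N := by
  simpa [ncRank] using Set.ncard_le_card (nonMin s)

/-- A step of `TailLE p q` that joins two blocks. -/
def JoinStep {N : ℕ} (p q : Fin N) (s t : Setoid (Fin N)) : Prop :=
  TailLE p q s t ∧ ∃ x y, IsJoin s t x y

theorem TailLE.reflTransGen {N : ℕ} {p q : Fin N} (hpq : (p : ℕ) + 1 = q)
    {s t : Setoid (Fin N)} (h : TailLE p q s t) : Relation.ReflTransGen (JoinStep p q) s t := by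
  induction hd : N - ncRank s using Nat.strong_induction_on generalizing s with
  | _ d ih =>
  by_cases hst : s = t
  · exact hst ▸ .refl
  obtain ⟨u, x, y, hj, hsu, hut⟩ := h.exists_isJoin hpq hst
  have := hj.ncRank_eq
  have := ncRank_le u
  exact .head ⟨hsu, x, y, hj⟩ (ih _ (by omega) hut rfl)

/-- A path of steps, with the partitions indexed by their rank. -/
theorem exists_path_of_reflTransGen {N : ℕ} {p q : Fin N} {s t : Setoid (Fin N)}
    (h : Relation.ReflTransGen (JoinStep p q) s t) :
    ∃ c : ℕ → Setoid (Fin N), ncRank s ≤ ncRank t ∧ c (ncRank s) = s ∧ c (ncRank t) = t ∧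
      ∀ i, ncRank s ≤ i → i < ncRank t → JoinStep p q (c i) (c (i + 1)) := by
  induction h with
  | refl => exact ⟨fun _ => s, le_rfl, rfl, rfl, fun i h h' => absurd h h'.not_ge⟩
  | @tail u v _ huv ih =>
    obtain ⟨c, hle, hs, hu, hc⟩ := ih
    obtain ⟨-, x, y, hj⟩ := id huv
    have hr := hj.ncRank_eq
    refine ⟨fun i => if i ≤ ncRank u then c i else v, by omega, by simp [hle, hs],
      by simp [hr], fun i hi hi' => ?_⟩
    rcases (show i ≤ ncRank u by omega).eq_or_lt with rfl | hlt
    · simpa [hu] using huv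
    · have h1 : i ≤ ncRank u := hlt.le
      have h2 : i + 1 ≤ ncRank u := hlt
      simp only [h1, h2, if_true]
      exact hc i hi hlt

/-! ### The poset of a set of parking functions -/

/-- A tuple of positive integers that is bounded by distinct elements of `{1, …, n}` is a parking
function. -/
theorem mem_parkingFunctions_of_injective {n : ℕ} {a : Fin n → ℕ} {y : Fin n → Fin (n + 1)}
    (hy : Function.Injective y) (ha : ∀ i, 1 ≤ a i) (hay : ∀ i, a i ≤ y i) :
    a ∈ ParkingFunctions n := by
  refine ⟨ha, Tuple.sort a, Tuple.monotone_sort a, fun i => ?_⟩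
  by_contra! hlt
  have hb : (i : ℕ) + 2 < n + 1 := by
    have := hay (Tuple.sort a i)
    omega
  have hcard := Finset.card_le_card_of_injOn (s := Finset.Ici i)
    (t := Finset.Ici (⟨i + 2, hb⟩ : Fin (n + 1))) (fun j => y (Tuple.sort a j))
    (fun j hj => ?_) (fun j _ j' _ h => (Tuple.sort a).injective (hy h))
  · rw [Fin.card_Ici, Fin.card_Ici] at hcard
    simp only at hcard
    omega
  · have h1 : a (Tuple.sort a i) ≤ a (Tuple.sort a j) :=
      Tuple.monotone_sort a (Finset.mem_Ici.1 (Finset.mem_coe.1 hj))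
    have h2 := hay (Tuple.sort a j)
    simp only [Finset.coe_Ici, Set.mem_Ici, Fin.le_def]
    omega

section
variable {n : ℕ} {p q : Fin (n + 1)}

/-- No covering relation of `TailLE p q` has the label of `p`: if `y = q`, the minimum of the block
of `p` would have to drop, but joining with elements larger than `p` cannot change it; if
`q < y`, the predecessor of `y` would be a larger candidate for the label. -/
theorem IsJoin.left_ne {s t : Setoid (Fin (n + 1))} {x y : Fin (n + 1)} (hj : IsJoin s t x y)
    (hpq : (p : ℕ) + 1 = q) (h : TailLE p q s t) : x ≠ p := by
  rintro rfl
  have hqy : q ≤ y := by rw [Fin.le_def]; have := Fin.lt_def.1 hj.lt; omega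
  have hxq : x < q := Fin.lt_def.2 (by omega)
  rcases hqy.eq_or_lt with rfl | hqy
  · obtain ⟨z, hz, hz'⟩ := h.1.2 hj.rel hj.not_rel
    rcases hj.rel_left_iff.1 hz with h' | h'
    · exact lt_irrefl _ (hz' z h')
    · exact (hj.min z h').not_gt ((hz' x (s.refl' x)).trans hj.lt)
  · have hy : (q : ℕ) < y := hqy
    have hl := h.2.2 x y ⟨y - 1, by omega⟩ hqy hj.lt hj.rel (by simp only; omega)
    rcases hj.rel_left_iff.1 (t.trans' hl (t.symm' hj.rel)) with h' | h'
    · have := Fin.le_def.1 (hj.pred _ h' (Fin.lt_def.2 (by simp only; omega)))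
      simp only at this
      omega
    · have := Fin.le_def.1 (hj.min _ h')
      simp only at this
      omega

/-- The step that joins `l'` to its predecessor `l` has label `l`. -/
theorem IsJoin.eq_of_tailChained {s t : Setoid (Fin (n + 1))} {x y l l' : Fin (n + 1)}
    (hj : IsJoin s t x y) (hs : TailChained q s) (hql : q < l') (hll' : (l : ℕ) + 1 = l')
    (h : ¬ s l l') (h' : t l l') : x = l := by
  have hlt : l < l' := Fin.lt_def.2 (by omega)
  have hmin : ∀ z, s z l' → l' ≤ z := fun z hz =>
    not_lt.1 fun hzl => h (hs z l' l hql hzl hz hll')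
  rcases hj.rel_iff.1 h' with h1 | ⟨h1, h2⟩ | ⟨h1, h2⟩
  · exact absurd h1 h
  · obtain rfl : y = l' := le_antisymm (hj.min _ h2) (hmin _ (s.symm' h2))
    refine le_antisymm ?_ (hj.pred _ h1 hlt)
    rw [Fin.le_def]
    have := Fin.lt_def.1 hj.lt
    omega
  · exact absurd ((hmin x (s.symm' h2)).trans_lt hj.lt) (not_lt.2 ((hj.min l h1).trans hlt.le))

/-- A chain of steps of `TailLE p q` from bottom to top has its labels in `PF_{n,q}`. The minima `y
i` of the absorbed blocks are distinct and larger than the corresponding positions `x i`, which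
gives the parking condition. -/
theorem exists_mem_PFChains (hpq : (p : ℕ) + 1 = q) {c : ℕ → Setoid (Fin (n + 1))}
    (h0 : c 0 = ⊥) (hn : c n = ⊤) (hc : ∀ i < n, JoinStep p q (c i) (c (i + 1))) :
    ∃ C ∈ PFChains n q, ∀ i : Fin (n + 1), (C i).1 = c i := by
  have hnc : ∀ i : Fin (n + 1), Noncrossing (c i) := by
    intro i
    rcases (Nat.lt_succ_iff.1 i.2).eq_or_lt with h | h
    · rw [h, hn]
      exact noncrossing_top
    · exact (hc i h).1.1.1.1
  let C : Fin (n + 1) → NC (n + 1) := fun i => ⟨c i, hnc i⟩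
  choose x y hj using fun i : Fin n => (hc i i.2).2
  have hmono : ∀ i j, i ≤ j → j ≤ n → c i ≤ c j := by
    intro i j hij
    induction j, hij using Nat.le_induction with
    | base => exact fun _ => le_rfl
    | succ j hij ih => exact fun h => (ih (by omega)).trans (hc j h).1.1.1.2.2
  have hy : Function.Injective y := by
    have key : ∀ i j, i < j → y i ≠ y j := by
      intro i j hij heq
      have h1 : c j (x i) (y i) := hmono (i + 1) j hij j.2.le (hj i).rel
      exact ((hj j).min _ (heq ▸ h1)).not_gt (heq ▸ (hj i).lt)
    intro i j hij
    by_contra hne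
    rcases lt_or_gt_of_ne hne with h | h
    · exact key i j h hij
    · exact key j i h hij.symm
  refine ⟨C, ⟨⟨?_, fun i => IsJoin.covBy (hj i), ?_⟩, fun i => x i + 1, ⟨?_, fun i => ?_, ?_⟩,
    fun i => IsJoin.isEdgeLabel (hj i)⟩, fun _ => rfl⟩
  · intro s u v huv
    have h : c 0 u v := huv
    rw [h0] at h
    obtain rfl : u = v := h
    exact s.1.refl' _
  · intro s u v _
    change c n u v
    rw [hn]
    trivial
  · exact mem_parkingFunctions_of_injective hy (fun i => Nat.le_add_left 1 _) fun i => (hj i).lt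
  · have := (hj i).left_ne hpq (hc i i.2).1
    rw [Ne, Fin.ext_iff] at this
    change (x i : ℕ) + 1 ≠ q
    omega
  · intro l hql hln
    let l₁ : Fin (n + 1) := ⟨l - 1, by omega⟩
    let l₂ : Fin (n + 1) := ⟨l, by omega⟩
    by_contra! hne
    have key : ∀ i, i ≤ n → ¬ c i l₁ l₂ := by
      intro i
      induction i with
      | zero =>
        intro _ h
        rw [h0] at h
        have : l - 1 = l := congrArg Fin.val (show l₁ = l₂ from h)
        omega
      | succ i ih =>
        intro hi h
        have hl : (l₁ : ℕ) + 1 = l₂ := by simp only [l₁, l₂]; omega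
        have h1 : x ⟨i, hi⟩ = l₁ := (hj ⟨i, hi⟩).eq_of_tailChained (hc i hi).1.2.1
          (Fin.lt_def.2 hql) hl (ih (by omega)) h
        refine hne ⟨i, hi⟩ ?_
        rw [h1]
        exact hl
    refine key n le_rfl ?_
    rw [hn]
    trivial

theorem exists_path (hpq : (p : ℕ) + 1 = q) {s t : Setoid (Fin (n + 1))} (h : TailLE p q s t) :
    ∃ c : ℕ → Setoid (Fin (n + 1)), ncRank s ≤ ncRank t ∧ c (ncRank s) = s ∧ c (ncRank t) = t ∧
      ∀ i, ncRank s ≤ i → i < ncRank t → JoinStep p q (c i) (c (i + 1)) :=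
  exists_path_of_reflTransGen (h.reflTransGen hpq)

theorem JoinStep.exists_PFEdge (hpq : (p : ℕ) + 1 = q) {σ τ : NC (n + 1)}
    (h : JoinStep p q σ.1 τ.1) (hσ : TailLE p q ⊥ σ.1) (hτ : TailLE p q τ.1 ⊤) :
    PFEdge n q σ τ := by
  obtain ⟨c₁, -, h1, h2, h3⟩ := exists_path hpq hσ
  obtain ⟨c₂, h4, h5, h6, h7⟩ := exists_path hpq hτ
  obtain ⟨-, x, y, hj⟩ := id h
  have hr := hj.ncRank_eq
  have hr' : ¬ ncRank τ.1 ≤ ncRank σ.1 := by omega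
  rw [ncRank_bot] at h1 h3
  rw [ncRank_top] at h4 h6 h7
  obtain ⟨C, hC, hCc⟩ := exists_mem_PFChains hpq
    (c := fun i => if i ≤ ncRank σ.1 then c₁ i else c₂ i) (by simpa using h1)
    (by simpa [show ¬ n ≤ ncRank σ.1 by omega] using h6) (fun i hi => by
      rcases lt_trichotomy i (ncRank σ.1) with hlt | rfl | hlt
      · have h8 : i ≤ ncRank σ.1 := hlt.le
        have h9 : i + 1 ≤ ncRank σ.1 := hlt
        simpa only [h8, h9, if_true] using h3 i (Nat.zero_le _) hlt
      · simpa [h2, ← hr, h5, hr'] using h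
      · have h8 : ¬ i ≤ ncRank σ.1 := by omega
        have h9 : ¬ i + 1 ≤ ncRank σ.1 := by omega
        simpa only [h8, h9, if_false] using h7 i (by omega) hi)
  refine ⟨C, hC, ⟨ncRank σ.1, by omega⟩, Subtype.ext ?_, Subtype.ext ?_⟩
  · simp [hCc, h2]
  · simp [hCc, ← hr, h5, hr']

theorem exists_mem_chain_of_tailLE (hpq : (p : ℕ) + 1 = q) {π : NC (n + 1)}
    (hbot : TailLE p q ⊥ π.1) (htop : TailLE p q π.1 ⊤) :
    ∃ c ∈ PFChains n q, ∃ i : Fin (n + 1), c i = π := by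
  obtain ⟨c₁, -, h1, h2, h3⟩ := exists_path hpq hbot
  obtain ⟨c₂, h4, h5, h6, h7⟩ := exists_path hpq htop
  rw [ncRank_bot] at h1 h3
  rw [ncRank_top] at h4 h6 h7
  obtain ⟨C, hC, hCc⟩ := exists_mem_PFChains hpq
    (c := fun i => if i < ncRank π.1 then c₁ i else c₂ i)
    (by
      by_cases h : 0 < ncRank π.1
      · simpa [h] using h1
      · have h0 : ncRank π.1 = 0 := by omega
        rw [h0] at h2 h5
        simp [h5, ← h2, h1])
    (by simpa [show ¬ n < ncRank π.1 by omega] using h6) (fun i hi => by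
      rcases lt_or_ge i (ncRank π.1) with hlt | hge
      · rcases (show i + 1 ≤ ncRank π.1 from hlt).eq_or_lt with heq | hlt'
        · have := h3 i (Nat.zero_le _) hlt
          rw [heq, h2] at this
          simpa [hlt, heq, h5] using this
        · simpa only [hlt, hlt', if_true] using h3 i (Nat.zero_le _) hlt
      · have h8 : ¬ i < ncRank π.1 := by omega
        have h9 : ¬ i + 1 < ncRank π.1 := by omega
        simpa only [h8, h9, if_false] using h7 i hge hi)
  refine ⟨C, hC, ⟨ncRank π.1, by omega⟩, Subtype.ext ?_⟩
  simp [hCc, h5]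

/-- The chains that correspond to `PF_{n,q}` are chains of `TailLE p q`. -/
theorem PFChains.tailLE (hpq : (p : ℕ) + 1 = q) {c : Fin (n + 1) → NC (n + 1)}
    (hc : c ∈ PFChains n q) :
    (c 0).1 = ⊥ ∧ (c (Fin.last n)).1 = ⊤ ∧
      ∀ i : Fin n, TailLE p q (c i.castSucc).1 (c i.succ).1 := by
  obtain ⟨⟨hbot, hcov, htop⟩, a, ⟨-, hak, hal⟩, hlab⟩ := hc
  choose x y hj hax using fun i => (hlab i).exists_isJoin (hcov i)
  have hmono : Monotone c := Fin.monotone_iff_le_succ.2 fun i => (hcov i).le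
  have hafter : ∀ {i j : Fin n}, i < j → (c j.castSucc).1 (x i) (y i) := fun {i j} hij =>
    hmono (show i.succ ≤ j.castSucc from hij) (hj i).rel
  have hplt : p < q := Fin.lt_def.2 (by omega)
  -- the step with label `l ≥ q` absorbs the block with minimum `l + 1`; by induction this holds for
  -- the larger labels, so that a larger `y i` would already be joined to its predecessor
  have hlabel : ∀ d l : ℕ, l + 1 + d = n → (q : ℕ) ≤ l →
      ∃ i, (x i : ℕ) = l ∧ (y i : ℕ) = l + 1 := by
    intro d
    induction d using Nat.strong_induction_on with
    | _ d ih =>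
    intro l hl hql
    obtain ⟨i, hi⟩ := hal (l + 1) (by omega) (by omega)
    have hxi : (x i : ℕ) = l := by have := hax i; omega
    refine ⟨i, hxi, ?_⟩
    by_contra hne
    have hxy : (x i : ℕ) < y i := (hj i).lt
    have hyn := (y i).2
    obtain ⟨j, hxj, hyj⟩ := ih (n - y i) (by omega) (y i - 1) (by omega) (by omega)
    have hyij : y i = y j := Fin.ext (by omega)
    rcases lt_trichotomy i j with hij | rfl | hij
    · have := Fin.le_def.1 ((hj j).min _ (hyij ▸ hafter hij))
      omega
    · omega
    · have := Fin.le_def.1 ((hj i).min _ (hyij ▸ hafter hij))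
      omega
  -- before that step `l + 1` is the minimum of its block, and after it `l + 1` is related to `l`
  have htail : ∀ i, TailChained q (c i).1 := by
    intro i u v l hqv huv h hl
    obtain ⟨e, hxe, hye⟩ := hlabel (n - v) l (by have := v.2; omega)
      (by have := Fin.lt_def.1 hqv; omega)
    obtain rfl : x e = l := Fin.ext hxe
    obtain rfl : y e = v := Fin.ext (by omega)
    rcases le_or_gt e.succ i with hei | hei
    · exact hmono hei (hj e).rel
    · have hie : i ≤ e.castSucc := Fin.le_castSucc_iff.2 hei
      exact absurd ((hj e).min u (hmono hie h)) huv.not_ge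
  refine ⟨le_antisymm (hbot ⟨⊥, noncrossing_bot⟩) bot_le,
    le_antisymm le_top (htop ⟨⊤, noncrossing_top⟩), fun i =>
    ⟨⟨⟨(c _).2, (c _).2, (hcov i).le⟩, fun ht hs => ?_⟩, htail _, htail _⟩⟩
  set s := (c i.castSucc).1
  rcases (hj i).rel_iff.1 ht with h | ⟨h1, h2⟩ | ⟨h1, h2⟩
  · exact absurd h hs
  · exfalso
    have hxp : x i ≠ p := by
      intro h
      exact hak i (by rw [hax, h]; exact hpq)
    rcases ((hj i).min q h2).eq_or_lt with heq | hlt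
    · have h3 : p ≤ x i := (hj i).pred p h1 (heq ▸ hplt)
      have h4 := (hj i).lt
      rw [heq] at h4
      refine hxp (le_antisymm ?_ h3)
      rw [Fin.le_def]
      have := Fin.lt_def.1 h4
      omega
    · have hyp : y i < p := by
        refine lt_of_le_of_ne (by rw [Fin.le_def]; have := Fin.lt_def.1 hlt; omega) ?_
        intro heq
        exact hs (s.symm' (heq ▸ h2))
      exact (hj i).not_rel ((c i.castSucc).2 (x i) (y i) p q (hj i).lt hyp hplt (s.symm' h1)
        (s.symm' h2))
  · refine ⟨x i, (hj i).rel_iff.2 (.inr (.inl ⟨s.refl' _, h1⟩)), fun z hz => ?_⟩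
    exact (hj i).lt.trans_le ((hj i).min z (s.trans' hz h1))

theorem PFEdge.tailLE (hpq : (p : ℕ) + 1 = q) {σ τ : NC (n + 1)} (h : PFEdge n q σ τ) :
    TailLE p q σ.1 τ.1 := by
  obtain ⟨c, hc, i, rfl, rfl⟩ := h
  exact (PFChains.tailLE hpq hc).2.2 i

theorem PosetPF.bot_tailLE_and_tailLE_top (hpq : (p : ℕ) + 1 = q) (π : PosetPF n q) :
    TailLE p q ⊥ π.1.1 ∧ TailLE p q π.1.1 ⊤ := by
  obtain ⟨π, c, hc, i, rfl⟩ := π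
  obtain ⟨h0, hn, h⟩ := PFChains.tailLE hpq hc
  have hpos : 0 < n := by have := q.2; omega
  obtain ⟨m, rfl⟩ : ∃ m, n = m + 1 := ⟨n - 1, by omega⟩
  constructor
  · induction i using Fin.induction with
    | zero => exact h0 ▸ (h 0).refl_left
    | succ i ih => exact ih.trans (h i)
  · induction i using Fin.reverseInduction with
    | last => exact hn ▸ (h (Fin.last m)).refl_right
    | cast i ih => exact (h i).trans ih

/-- The order by paths along the chains of `PF_{n,q}` is the order `TailLE p q`. -/
theorem PosetPF.le_iff_tailLE (hpq : (p : ℕ) + 1 = q) (σ τ : PosetPF n q) :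
    σ ≤ τ ↔ TailLE p q σ.1.1 τ.1.1 := by
  have hσ := σ.bot_tailLE_and_tailLE_top hpq
  have hτ := τ.bot_tailLE_and_tailLE_top hpq
  constructor
  · intro h
    change Relation.ReflTransGen (PFEdge n q) σ.1 τ.1 at h
    generalize τ.1 = t at h
    induction h with
    | refl => exact hσ.2.refl_left
    | tail _ h ih => exact ih.trans (h.tailLE hpq)
  · intro h
    change Relation.ReflTransGen (PFEdge n q) σ.1 τ.1
    have key : ∀ t, Relation.ReflTransGen (JoinStep p q) σ.1.1 t → TailLE p q t ⊤ →
        ∀ t' : NC (n + 1), t'.1 = t → Relation.ReflTransGen (PFEdge n q) σ.1 t' := by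
      intro t ht
      induction ht with
      | refl =>
        intro _ t' ht'
        obtain rfl : t' = σ.1 := Subtype.ext ht'
        exact .refl
      | @tail u v hu huv ih =>
        rintro hv ⟨_, hv'⟩ rfl
        have hσu : TailLE p q ⊥ u := by
          have hle : ∀ w, Relation.ReflTransGen (JoinStep p q) σ.1.1 w → TailLE p q ⊥ w := by
            intro w hw
            induction hw with
            | refl => exact hσ.1
            | tail _ h ih => exact ih.trans h.1
          exact hle u hu
        exact .tail (ih (huv.1.trans hv) ⟨u, huv.1.1.1.1⟩ rfl)
          (JoinStep.exists_PFEdge (σ := ⟨u, huv.1.1.1.1⟩) (τ := ⟨_, hv'⟩) hpq huv hσu hv)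
    exact key _ (h.reflTransGen hpq) hτ.2 _ rfl

/-- `Poset(PF_{n,q})` consists of the partitions between `⊥` and `⊤` with respect to `TailLE p q`. -/
theorem PosetPF.nonempty_iso (hpq : (p : ℕ) + 1 = q) :
    Nonempty (RelIcc (TailLE p q) ⊥ ⊤ ≃o PosetPF n q) :=
  ⟨OrderIso.symm
    { toFun := fun π => ⟨π.1.1, π.bot_tailLE_and_tailLE_top hpq⟩
      invFun := fun s => ⟨⟨s.1, s.2.1.1.1.2.1⟩, exists_mem_chain_of_tailLE hpq s.2.1 s.2.2⟩
      left_inv := fun _ => rfl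
      right_inv := fun _ => rfl
      map_rel_iff' := fun {σ τ} => (PosetPF.le_iff_tailLE hpq σ τ).symm }⟩

theorem PosetPF.nonempty_Icc_iso (hpq : (p : ℕ) + 1 = q) (σ τ : PosetPF n q) :
    Nonempty (Set.Icc σ τ ≃o RelIcc (TailLE p q) σ.1.1 τ.1.1) :=
  have hσ := σ.bot_tailLE_and_tailLE_top hpq
  have hτ := τ.bot_tailLE_and_tailLE_top hpq
  ⟨{ toFun := fun π => ⟨π.1.1.1, (PosetPF.le_iff_tailLE hpq _ _).1 π.2.1,
        (PosetPF.le_iff_tailLE hpq _ _).1 π.2.2⟩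
     invFun := fun s =>
      have hmem := exists_mem_chain_of_tailLE (π := ⟨s.1, s.2.1.1.1.2.1⟩) hpq
        (hσ.1.trans s.2.1) (s.2.2.trans hτ.2)
      ⟨⟨⟨s.1, s.2.1.1.1.2.1⟩, hmem⟩, (PosetPF.le_iff_tailLE hpq σ ⟨_, hmem⟩).2 s.2.1,
        (PosetPF.le_iff_tailLE hpq ⟨_, hmem⟩ τ).2 s.2.2⟩
     left_inv := fun _ => rfl
     right_inv := fun _ => rfl
     map_rel_iff' := fun {π ρ} => (PosetPF.le_iff_tailLE hpq π.1 ρ.1).symm }⟩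

end

/-! ### Decomposition of the intervals -/

theorem tailChained_last {n : ℕ} (s : Setoid (Fin (n + 1))) : TailChained (Fin.last n) s :=
  fun _ y _ hy => absurd hy (Fin.le_last y).not_gt

theorem nonempty_relIcc_tailLE_last_iso {n : ℕ} (p : Fin (n + 1)) (σ τ : Setoid (Fin (n + 1))) :
    Nonempty (RelIcc (TailLE p (Fin.last n)) σ τ ≃o RelIcc (MarkedLE p (Fin.last n)) σ τ) :=
  RelIcc.congrIso Set.univ trivial trivial (fun _ _ _ => trivial) (fun _ _ _ => trivial)
    (fun _ _ _ _ => ⟨fun h => h.1, fun h => ⟨h, tailChained_last _, tailChained_last _⟩⟩)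

theorem nonempty_relIcc_markedLE_iso_posetPF {r : ℕ} (p q : Fin (r + 1))
    (hp : (p : ℕ) + 1 = r) (hq : (q : ℕ) = r) :
    Nonempty (RelIcc (MarkedLE p q) ⊥ ⊤ ≃o PosetPF r r) := by
  obtain rfl : q = Fin.last r := Fin.ext hq
  obtain ⟨e⟩ := nonempty_relIcc_tailLE_last_iso p ⊥ ⊤
  obtain ⟨e'⟩ := PosetPF.nonempty_iso (p := p) (q := Fin.last r) hp
  exact ⟨e.symm.trans e'⟩

/-- The intervals of the marked order for the two largest elements `p < q`. Splitting along a block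
of `τ`, or along two related elements of `σ`, leaves at most one factor to which the marking
applies, and only the full interval from the finest to the coarsest partition does not split. -/
theorem isProdPF_relIcc_markedLE {α : Type} [LinearOrder α] [Finite α] {p q : α} (hpq : p < q)
    (hq : ∀ x, x ≤ p ∨ x = q)    {σ τ : Setoid α}
    (h : MarkedLE p q σ τ) : IsProdPF (RelIcc (MarkedLE p q) σ τ) := by
  induction hN : Nat.card α using Nat.strong_induction_on generalizing α with
  | _ N ih =>
  subst hN
  by_cases hσpq : σ p q
  · obtain ⟨e⟩ := markedLE_iso_of_minDrops (p := p) (q := q) h.1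
      (fun s t hs _ _ _ hspq => absurd (hs.2.2 hσpq) hspq)
    exact .inl ((isProdNC_relIcc_nCLe h.1).congr e)
  by_cases hτpq : τ p q
  swap
  · obtain ⟨e⟩ := markedLE_iso_of_minDrops (p := p) (q := q) h.1
      (fun s t _ _ ht htpq => absurd (ht.2.2 htpq) hτpq)
    exact .inl ((isProdNC_relIcc_nCLe h.1).congr e)
  by_cases hτ : ∀ x y, τ x y
  · obtain rfl := Setoid.eq_top_of_forall hτ
    by_cases hσ : ∃ a b, a < b ∧ σ a b
    · obtain ⟨a, b, hab, hσ⟩ := hσ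
      rcases eq_or_ne b q with rfl | hbq
      · have hap : a < p := by
          refine lt_of_le_of_ne ((hq a).resolve_right hab.ne) ?_
          rintro rfl
          exact hσpq hσ
        -- the block of `b` contains the element `a` to the left of the block of `p`
        obtain ⟨e⟩ := markedLE_iso_of_minDrops (p := p) (q := b) h.1
          (fun s t hs ht _ => minDrops_of_rel_of_lt ht.1 ht.2.2 hap hpq (hs.2.2 hσ))
        exact .inl ((isProdNC_relIcc_nCLe h.1).congr e)
      · have hb : b ∈ Set.Ioc a b := ⟨hab, le_rfl⟩
        have hbp : b ≤ p := (hq b).resolve_right hbq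
        have hqC : q ∈ (Set.Ioc a b)ᶜ := fun hq => (hbp.trans_lt hpq).not_ge hq.2
        -- the second largest element outside `Ioc a b` takes the role of `p`
        obtain ⟨p', hp', hpp'⟩ : ∃ p' ∈ (Set.Ioc a b)ᶜ, p' = p ∨ p' = a ∧ p = b := by
          by_cases hp : p ∈ Set.Ioc a b
          · exact ⟨a, by simp, .inr ⟨rfl, le_antisymm hp.2 hbp⟩⟩
          · exact ⟨p, hp, .inl rfl⟩
        obtain ⟨e⟩ := markedLE_split_of_rel h hab hσ hp' hqC hpp'
        have h' := (markedLE_iff_of_rel hp' hqC hpp' h.1.1 h.1.2.1 hσ trivial).1 h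
        have hap : a < p := hab.trans_le hbp
        refine (IsProdPF.prod (ih _ ?_ (p := (⟨p', hp'⟩ : ↑(Set.Ioc a b)ᶜ))
          (q := ⟨q, hqC⟩) ?_ ?_ h'.1 rfl)
          (isProdNC_relIcc_nCLe h'.2)).congr e
        · exact Finite.card_subtype_lt (x := b) (fun hb' => hb' hb)
        · obtain rfl | ⟨rfl, -⟩ := hpp'
          · exact hpq
          · exact hap.trans hpq
        · rintro ⟨x, hx⟩
          simp only [Subtype.mk_le_mk, Subtype.mk.injEq]
          refine (hq x).imp_left fun hxp => ?_
          obtain rfl | ⟨rfl, rfl⟩ := hpp'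
          · exact hxp
          · exact not_lt.1 fun hlt => hx ⟨hlt, hxp⟩
    · push Not at hσ
      obtain rfl := Setoid.eq_bot_of_forall_lt hσ
      cases nonempty_fintype α
      obtain ⟨x, -, hx⟩ := h.2 trivial hσpq
      have hxp : x < p := hx p rfl
      obtain ⟨r, hr⟩ : ∃ r, Fintype.card α = r + 1 :=
        Nat.exists_eq_succ_of_ne_zero (Fintype.card_pos_iff.2 ⟨p⟩).ne'
      let e := (Fintype.orderIsoFinOfCardEq α hr).symm
      have hxp' : (e x : ℕ) < e p := e.lt_iff_lt.2 hxp
      have hpq' : (e p : ℕ) < e q := e.lt_iff_lt.2 hpq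
      have hqr : (e q : ℕ) = r := by
        obtain ⟨z, hz⟩ := e.surjective (Fin.last r)
        have hzq : z ≤ q := (hq z).elim (fun h => h.trans hpq.le) le_of_eq
        have : Fin.last r ≤ e q := hz ▸ e.monotone hzq
        exact le_antisymm (Nat.lt_succ_iff.1 (e q).2) this
      have hpr : (e p : ℕ) + 1 = r := by
        obtain ⟨z, hz⟩ := e.surjective ⟨r - 1, by omega⟩
        have hz' : (e z : ℕ) = r - 1 := by rw [hz]
        have : (e z : ℕ) ≤ e p := e.monotone <| (hq z).resolve_right <| by
          rintro rfl
          omega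
        omega
      obtain ⟨e₁⟩ := relIcc_bot_top_iso e (r := MarkedLE p q) (r' := MarkedLE (e p) (e q))
        (fun s t => and_congr (nCLe_comap_iff e s t) (minDrops_comap_iff e p q s t))
      obtain ⟨e₂⟩ := nonempty_relIcc_markedLE_iso_posetPF (e p) (e q) hpr hqr
      exact isProdPF_of_iso (by omega) (e₁.trans e₂)
  · push Not at hτ
    obtain ⟨x, y, hxy⟩ := hτ
    have hC : ∀ u v, τ u v → u ∈ {z | τ z p} → v ∈ {z | τ z p} :=
      fun u v huv hu => τ.trans' (τ.symm' huv) hu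
    obtain ⟨e⟩ := markedLE_split_of_saturated h hC (τ.refl' p) (τ.symm' hτpq)
    have h' := (markedLE_iff_of_saturated hC (τ.refl' p) (τ.symm' hτpq) h.1.1 h.1.2.1 h.1.2.2
      le_rfl).1 h
    obtain ⟨z, hz⟩ : ∃ z, ¬ τ z p := by
      by_contra! hall
      exact hxy (τ.trans' (hall x) (τ.symm' (hall y)))
    refine (IsProdPF.prod (ih _ ?_ (p := (⟨p, τ.refl' p⟩ : {z | τ z p}))
      (q := ⟨q, τ.symm' hτpq⟩) hpq ?_ h'.1 rfl)
      (isProdNC_relIcc_nCLe h'.2)).congr e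
    · exact Finite.card_subtype_lt (x := z) hz
    · rintro ⟨x, hx⟩
      simpa only [Subtype.mk_le_mk, Subtype.mk.injEq] using hq x

theorem isProdPF_relIcc_tailLE {n : ℕ} {p q : Fin (n + 1)} (hpq : (p : ℕ) + 1 = q)
    {σ τ : Setoid (Fin (n + 1))} (h : TailLE p q σ τ) : IsProdPF (RelIcc (TailLE p q) σ τ) := by
  have hmax : ∀ {n : ℕ} {p q : Fin (n + 1)} (_ : (p : ℕ) + 1 = q) (_ : q = Fin.last n)
      {σ τ : Setoid (Fin (n + 1))}, TailLE p q σ τ → IsProdPF (RelIcc (TailLE p q) σ τ) := by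
    rintro n p q hpq rfl σ τ h
    obtain ⟨e⟩ := nonempty_relIcc_tailLE_last_iso p σ τ
    refine (isProdPF_relIcc_markedLE (Fin.lt_def.2 (by omega)) (fun x => ?_) h.1).congr e
    have := x.2
    rw [Fin.le_def, Fin.ext_iff]
    simp only [Fin.val_last] at hpq ⊢
    omega
  induction n with
  | zero => exact absurd hpq (by omega)
  | succ n ih =>
    by_cases hq : q = Fin.last (n + 1)
    · exact hmax hpq hq h
    · obtain ⟨q, rfl⟩ := Fin.exists_castSucc_eq.2 hq
      obtain ⟨p, rfl⟩ := Fin.exists_castSucc_eq.2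
        (Fin.ne_last_of_lt (show p < q.castSucc from Fin.lt_def.2 (by omega)))
      obtain ⟨e⟩ := tailLE_split_last h
      have h' := (tailLE_iff_comap_castSucc h.1.1.1 h.1.1.2.1 h.2.1 h.2.2).1 h
      exact (IsProdPF.prod (ih hpq h'.1) (isProdNC_relIcc_prop h'.2)).congr e

theorem theoremA (n k : ℕ) (hk : 1 < k) (hkn : k ≤ n) (σ τ : PosetPF n k) (hστ : σ ≤ τ) :
    (∃ (j : ℕ) (m : Fin j → ℕ), (∀ i, 1 ≤ m i) ∧
      Nonempty (Set.Icc σ τ ≃o ((i : Fin j) → NC (m i)))) ∨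
    (∃ r : ℕ, 1 < r ∧ ∃ (j : ℕ) (m : Fin j → ℕ), (∀ i, 1 ≤ m i) ∧
      Nonempty (Set.Icc σ τ ≃o PosetPF r r × ((i : Fin j) → NC (m i)))) := by
  have hpq : ((⟨k - 1, by omega⟩ : Fin (n + 1)) : ℕ) + 1 = (⟨k, by omega⟩ : Fin (n + 1)) := by
    simp only
    omega
  obtain ⟨e⟩ := PosetPF.nonempty_Icc_iso hpq σ τ
  exact (isProdPF_relIcc_tailLE hpq ((PosetPF.le_iff_tailLE hpq σ τ).1 hστ)).congr e
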